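/- Let $V$ be a complex vector space of finite dimension $n$ with a non-degenerate bilinear form $(\cdot,\cdot)$ that is either symmetric or anti-symmetric, let $m\ge 0$ be an integer, and put $r=\min(m,[n/2])$. Let $$\mathcal{NCQ}=\{T\in \mathrm{Hom}(\mathbb C^m,V) \mid (Tx,Ty)=0 \text{ for all } x,y\in\mathbb C^m\}$$ be the null cone, a closed subvariety of the affine space $\mathrm{Hom}(\mathbb C^m,V)$. Let $J_r(V)$ be the variety of all $r$-dimensional isotropic subspaces of $V$, a closed subvariety of the Grassmannian of $r$-dimensional subspaces of $V$, and let $\mathrm{Taut}=\{(u,U)\in V\times J_r(V)\mid u\in U\}$ be the tautological bundle over $J_r(V)$. Put $$\widetilde{\mathcal{NCQ}}=\{(T,U)\in\mathcal{NCQ}\times J_r(V)\mid \operatorname{Im}T\subset U\},\qquad \pi_0(T,U)=U .$$ Then there is an isomorphism of varieties from $\widetilde{\mathcal{NCQ}}$ to the total space of the tensor product $\mathrm{Taut}\otimes\underline{\mathbb C}^m$ of the tautological bundle with the trivial bundle of rank $m$, which commutes with the projections to $J_r(V)$ and is linear on the fibres $\pi_0^{-1}(U)=\mathrm{Hom}(\mathbb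 C^m,U)$. In particular, $\widetilde{\mathcal{NCQ}}$ is a (non-empty) smooth variety, of pure dimension $r(2m+2n-3r-1)/2$ if the form is symmetric, and of pure dimension $r(2m+2n-3r+1)/2$ if the form is anti-symmetric. -/

import Mathlib

open scoped TensorProduct Topology

/-!
Classical complex algebraic geometry in the language of spaces with functions: a space with
functions is a topological space with a sheaf of complex valued functions, and a variety is a space
with functions that is covered by finitely many affine varieties and is separated.
-/

/-- A structure of *space with functions* on `X`: a topology, and for every point `x` the set of the
functions that are regular at `x` (that is, on some neighbourhood of `x`). Regularity at `x` depends
only on the germ at `x`, regular functions form a `ℂ`-algebra, and a regular function which does not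
vanish at `x` does not vanish near `x` and has a regular inverse at `x`.
A function on an open set is regular when it is regular at each point of this set. -/
structure FnStr (X : Type*) where
  top : TopologicalSpace X
  RegularAt : (X → ℂ) → X → Prop
  congr' : ∀ {f g : X → ℂ} {x : X}, (∀ᶠ y in @nhds X top x, f y = g y) →
    RegularAt f x → RegularAt g x
  eventually' : ∀ {f : X → ℂ} {x : X}, RegularAt f x → ∀ᶠ y in @nhds X top x, RegularAt f y
  const' : ∀ (c : ℂ) (x : X), RegularAt (fun _ => c) x
  add' : ∀ {f g : X → ℂ} {x : X}, RegularAt f x → RegularAt g x →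
    RegularAt (fun y => f y + g y) x
  mul' : ∀ {f g : X → ℂ} {x : X}, RegularAt f x → RegularAt g x →
    RegularAt (fun y => f y * g y) x
  ne_zero' : ∀ {f : X → ℂ} {x : X}, RegularAt f x → f x ≠ 0 → ∀ᶠ y in @nhds X top x, f y ≠ 0
  inv' : ∀ {f : X → ℂ} {x : X}, RegularAt f x → f x ≠ 0 → RegularAt (fun y => (f y)⁻¹) x

namespace FnStr

variable {X Y : Type*}

theorem eventually_iff (t : TopologicalSpace X) {P : X → Prop} {x : X} :
    (∀ᶠ y in @nhds X t x, P y) ↔ ∃ O : Set X, (∀ y ∈ O, P y) ∧ IsOpen[t] O ∧ x ∈ O :=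
  eventually_nhds_iff

/-- `f` is a morphism of spaces with functions: it is continuous and pulls regular functions back
to regular functions. -/
def IsMorphism (S : FnStr X) (T : FnStr Y) (f : X → Y) : Prop :=
  (∀ O : Set Y, IsOpen[T.top] O → IsOpen[S.top] (f ⁻¹' O)) ∧
    ∀ (g : Y → ℂ) (x : X), T.RegularAt g (f x) → S.RegularAt (fun y => g (f y)) x

/-- The bijection `e` is an isomorphism of spaces with functions. -/
def IsIsomorphism (S : FnStr X) (T : FnStr Y) (e : X ≃ Y) : Prop :=
  S.IsMorphism T e ∧ T.IsMorphism S e.symm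

/-- The structure induced along a map `i : Y → X`, used for subsets of `X` and for sets identified
with subsets of `X`: the induced topology, and the functions that are locally restrictions of
regular functions. -/
def comap (S : FnStr X) (i : Y → X) : FnStr Y where
  top := S.top.induced i
  RegularAt f y := ∃ F : X → ℂ, S.RegularAt F (i y) ∧
    ∀ᶠ z in @nhds Y (S.top.induced i) y, f z = F (i z)
  congr' := by
    rintro f g y h ⟨F, hF, hf⟩
    exact ⟨F, hF, by filter_upwards [h, hf] with z h1 h2 using h1 ▸ h2⟩
  eventually' := by
    let _ := S.top
    let _ := S.top.induced i
    rintro f y ⟨F, hF, hf⟩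
    have hc : Continuous i := continuous_induced_dom
    filter_upwards [hc.continuousAt.eventually (S.eventually' hF), hf.eventually_nhds]
      with z h1 h2 using ⟨F, h1, h2⟩
  const' c y := ⟨fun _ => c, S.const' c _, by simp⟩
  add' := by
    rintro f g y ⟨F, hF, hf⟩ ⟨G, hG, hg⟩
    exact ⟨_, S.add' hF hG, by filter_upwards [hf, hg] with z h1 h2 using by rw [h1, h2]⟩
  mul' := by
    rintro f g y ⟨F, hF, hf⟩ ⟨G, hG, hg⟩
    exact ⟨_, S.mul' hF hG, by filter_upwards [hf, hg] with z h1 h2 using by rw [h1, h2]⟩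
  ne_zero' := by
    let _ := S.top
    let _ := S.top.induced i
    rintro f y ⟨F, hF, hf⟩ h0
    have hc : Continuous i := continuous_induced_dom
    have h1 : F (i y) ≠ 0 := hf.self_of_nhds ▸ h0
    filter_upwards [hc.continuousAt.eventually (S.ne_zero' hF h1), hf]
      with z h2 h3 using h3 ▸ h2
  inv' := by
    let _ := S.top
    let _ := S.top.induced i
    rintro f y ⟨F, hF, hf⟩ h0
    have h1 : F (i y) ≠ 0 := hf.self_of_nhds ▸ h0
    exact ⟨_, S.inv' hF h1, by filter_upwards [hf] with z h2 using by rw [h2]⟩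

/-- The induced structure on a subset. -/
def restrict (S : FnStr X) (A : Set X) : FnStr A := S.comap (Subtype.val : A → X)

/-- The final structure for a family of maps `p i : Y i → X`: a set is open when all its preimages
are open, and a function on an open set is regular when all its pullbacks are regular. -/
def final {ι : Type*} {Y : ι → Type*} (S : ∀ i, FnStr (Y i)) (p : ∀ i, Y i → X) : FnStr X where
  top :=
    { IsOpen := fun O => ∀ i, IsOpen[(S i).top] (p i ⁻¹' O)
      isOpen_univ := fun i => @isOpen_univ _ (S i).top
      isOpen_inter := fun O O' h h' i => (S i).top.isOpen_inter _ _ (h i) (h' i)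
      isOpen_sUnion := fun s h i => by
        let _ := (S i).top
        rw [Set.preimage_sUnion]
        exact isOpen_biUnion fun t ht => h t ht i }
  RegularAt f x := ∃ O : Set X, (∀ i, IsOpen[(S i).top] (p i ⁻¹' O)) ∧ x ∈ O ∧
    ∀ i y, p i y ∈ O → (S i).RegularAt (fun z => f (p i z)) y
  congr' := by
    rintro f g x h ⟨O, hO, hx, hf⟩
    obtain ⟨N, hN, hNo, hxN⟩ := (eventually_iff _).1 h
    refine ⟨O ∩ N, fun i => (S i).top.isOpen_inter _ _ (hO i) (hNo i), ⟨hx, hxN⟩,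
      fun i y hy => (S i).congr' ?_ (hf i y hy.1)⟩
    exact (eventually_iff _).2 ⟨p i ⁻¹' N, fun z hz => hN _ hz, hNo i, hy.2⟩
  eventually' := by
    rintro f x ⟨O, hO, hx, hf⟩
    exact (eventually_iff _).2 ⟨O, fun z hz => ⟨O, hO, hz, hf⟩, hO, hx⟩
  const' c x := ⟨Set.univ, fun i => @isOpen_univ _ (S i).top, trivial,
    fun i y _ => (S i).const' c y⟩
  add' := by
    rintro f g x ⟨O, hO, hx, hf⟩ ⟨O', hO', hx', hg⟩
    exact ⟨O ∩ O', fun i => (S i).top.isOpen_inter _ _ (hO i) (hO' i), ⟨hx, hx'⟩,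
      fun i y hy => (S i).add' (hf i y hy.1) (hg i y hy.2)⟩
  mul' := by
    rintro f g x ⟨O, hO, hx, hf⟩ ⟨O', hO', hx', hg⟩
    exact ⟨O ∩ O', fun i => (S i).top.isOpen_inter _ _ (hO i) (hO' i), ⟨hx, hx'⟩,
      fun i y hy => (S i).mul' (hf i y hy.1) (hg i y hy.2)⟩
  ne_zero' := by
    rintro f x ⟨O, hO, hx, hf⟩ h0
    refine (eventually_iff _).2
      ⟨{z | z ∈ O ∧ f z ≠ 0}, fun z hz => hz.2, fun i => ?_, ⟨hx, h0⟩⟩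
    let _ := (S i).top
    rw [isOpen_iff_mem_nhds]
    rintro y ⟨hy, hy0⟩
    filter_upwards [(hO i).mem_nhds hy, (S i).ne_zero' (hf i y hy) hy0] with z h1 h2 using ⟨h1, h2⟩
  inv' := by
    rintro f x ⟨O, hO, hx, hf⟩ h0
    have hopen : ∀ i, IsOpen[(S i).top] (p i ⁻¹' {z | z ∈ O ∧ f z ≠ 0}) := by
      intro i
      let _ := (S i).top
      rw [isOpen_iff_mem_nhds]
      rintro y ⟨hy, hy0⟩
      filter_upwards [(hO i).mem_nhds hy, (S i).ne_zero' (hf i y hy) hy0]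
        with z h1 h2 using ⟨h1, h2⟩
    exact ⟨_, hopen, ⟨hx, h0⟩, fun i y hy => (S i).inv' (hf i y hy.1) hy.2⟩

/-- The structure generated by algebras `A i` of functions on sets `D i` (only the values on `D i`
matter): the sets `{z ∈ D i | b z ≠ 0}` with `b ∈ A i` form a basis of the topology, and the regular
functions are locally the quotients `a / b` with `a, b ∈ A i` on such sets. -/
def generate {ι : Type*} (D : ι → Set X) (A : ι → Subalgebra ℂ (X → ℂ))
    (cover : ∀ x, ∃ i, x ∈ D i)
    (inter : ∀ i j, ∃ k, D k = D i ∩ D j ∧ A i ≤ A k ∧ A j ≤ A k) : FnStr X :=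
  let top : TopologicalSpace X :=
    { IsOpen := fun O => ∀ x ∈ O, ∃ i, ∃ b ∈ A i, x ∈ D i ∧ b x ≠ 0 ∧
        ∀ y ∈ D i, b y ≠ 0 → y ∈ O
      isOpen_univ := fun x _ => by
        obtain ⟨i, hi⟩ := cover x
        exact ⟨i, 1, one_mem _, hi, by simp, fun _ _ _ => trivial⟩
      isOpen_inter := by
        rintro O O' h h' x ⟨hx, hx'⟩
        obtain ⟨i, b, hb, hxi, hbx, hO⟩ := h x hx
        obtain ⟨j, b', hb', hxj, hbx', hO'⟩ := h' x hx'
        obtain ⟨k, hk, hik, hjk⟩ := inter i j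
        refine ⟨k, b * b', mul_mem (hik hb) (hjk hb'), hk ▸ ⟨hxi, hxj⟩, mul_ne_zero hbx hbx', ?_⟩
        intro y hy hy0
        rw [hk] at hy
        exact ⟨hO y hy.1 (left_ne_zero_of_mul hy0), hO' y hy.2 (right_ne_zero_of_mul hy0)⟩
      isOpen_sUnion := by
        rintro s h x ⟨O, hO, hx⟩
        obtain ⟨i, b, hb, hxi, hbx, hs⟩ := h O hO x hx
        exact ⟨i, b, hb, hxi, hbx, fun y hy hy0 => ⟨O, hO, hs y hy hy0⟩⟩ }
  have basic : ∀ i, ∀ b ∈ A i, ∀ x ∈ D i, b x ≠ 0 →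
      ∀ᶠ y in @nhds X top x, y ∈ D i ∧ b y ≠ 0 := fun i b hb x hx hbx =>
    (eventually_iff _).2 ⟨{y | y ∈ D i ∧ b y ≠ 0}, fun _ hy => hy,
      fun _ hy => ⟨i, b, hb, hy.1, hy.2, fun _ hz hz0 => ⟨hz, hz0⟩⟩, ⟨hx, hbx⟩⟩
  { top := top
    RegularAt := fun f x => ∃ i, ∃ a ∈ A i, ∃ b ∈ A i, x ∈ D i ∧ b x ≠ 0 ∧
      ∀ y ∈ D i, b y ≠ 0 → f y = a y / b y
    congr' := by
      rintro f g x h ⟨i, a, ha, b, hb, hx, hbx, hf⟩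
      obtain ⟨N, hN, hNo, hxN⟩ := (eventually_iff _).1 h
      obtain ⟨j, c, hc, hxj, hcx, hcN⟩ := hNo x hxN
      obtain ⟨k, hk, hik, hjk⟩ := inter i j
      refine ⟨k, a * c, mul_mem (hik ha) (hjk hc), b * c, mul_mem (hik hb) (hjk hc),
        hk ▸ ⟨hx, hxj⟩, mul_ne_zero hbx hcx, ?_⟩
      intro y hy hy0
      rw [hk] at hy
      have h1 := left_ne_zero_of_mul hy0
      have h2 := right_ne_zero_of_mul hy0
      rw [← hN y (hcN y hy.2 h2), hf y hy.1 h1]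
      exact (mul_div_mul_right _ _ h2).symm
    eventually' := by
      rintro f x ⟨i, a, ha, b, hb, hx, hbx, hf⟩
      filter_upwards [basic i b hb x hx hbx] with y hy using ⟨i, a, ha, b, hb, hy.1, hy.2, hf⟩
    const' := fun c x => by
      obtain ⟨i, hi⟩ := cover x
      exact ⟨i, algebraMap ℂ _ c, (A i).algebraMap_mem c, 1, one_mem _, hi, by simp,
        fun y _ _ => by simp⟩
    add' := by
      rintro f g x ⟨i, a, ha, b, hb, hx, hbx, hf⟩ ⟨j, a', ha', b', hb', hx', hbx', hg⟩
      obtain ⟨k, hk, hik, hjk⟩ := inter i j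
      refine ⟨k, a * b' + b * a', add_mem (mul_mem (hik ha) (hjk hb')) (mul_mem (hik hb) (hjk ha')),
        b * b', mul_mem (hik hb) (hjk hb'), hk ▸ ⟨hx, hx'⟩, mul_ne_zero hbx hbx', ?_⟩
      intro y hy hy0
      rw [hk] at hy
      have h1 := left_ne_zero_of_mul hy0
      have h2 := right_ne_zero_of_mul hy0
      simp only [hf y hy.1 h1, hg y hy.2 h2]
      exact div_add_div _ _ h1 h2
    mul' := by
      rintro f g x ⟨i, a, ha, b, hb, hx, hbx, hf⟩ ⟨j, a', ha', b', hb', hx', hbx', hg⟩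
      obtain ⟨k, hk, hik, hjk⟩ := inter i j
      refine ⟨k, a * a', mul_mem (hik ha) (hjk ha'),
        b * b', mul_mem (hik hb) (hjk hb'), hk ▸ ⟨hx, hx'⟩, mul_ne_zero hbx hbx', ?_⟩
      intro y hy hy0
      rw [hk] at hy
      have h1 := left_ne_zero_of_mul hy0
      have h2 := right_ne_zero_of_mul hy0
      simp only [hf y hy.1 h1, hg y hy.2 h2]
      exact div_mul_div_comm _ _ _ _
    ne_zero' := by
      rintro f x ⟨i, a, ha, b, hb, hx, hbx, hf⟩ h0
      rw [hf x hx hbx] at h0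
      have hax : a x ≠ 0 := fun h => h0 (by rw [h, zero_div])
      filter_upwards [basic i (a * b) (mul_mem ha hb) x hx (mul_ne_zero hax hbx)] with y hy
      rw [hf y hy.1 (right_ne_zero_of_mul hy.2)]
      exact div_ne_zero (left_ne_zero_of_mul hy.2) (right_ne_zero_of_mul hy.2)
    inv' := by
      rintro f x ⟨i, a, ha, b, hb, hx, hbx, hf⟩ h0
      rw [hf x hx hbx] at h0
      have hax : a x ≠ 0 := fun h => h0 (by rw [h, zero_div])
      refine ⟨i, b * b, mul_mem hb hb, a * b, mul_mem ha hb, hx, mul_ne_zero hax hbx, ?_⟩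
      intro y hy hy0
      have h2 := right_ne_zero_of_mul hy0
      simp only [hf y hy h2, inv_div]
      exact (mul_div_mul_right _ _ h2).symm }

/-- The algebra of polynomial functions on a finite dimensional vector space: it is generated by
the linear forms. -/
def polynomialFunctions (W : Type*) [AddCommGroup W] [Module ℂ W] : Subalgebra ℂ (W → ℂ) :=
  Algebra.adjoin ℂ {f | ∃ φ : Module.Dual ℂ W, f = φ}

/-- The affine space of a finite dimensional vector space, with its Zariski topology; regular
functions are locally quotients of polynomial functions. -/
def affine (W : Type*) [AddCommGroup W] [Module ℂ W] : FnStr W :=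
  generate (fun _ : Unit => Set.univ) (fun _ => polynomialFunctions W)
    (fun _ => ⟨(), trivial⟩) (fun _ _ => ⟨(), by simp, le_rfl, le_rfl⟩)

/-- The algebra of functions on `O × P` generated by the regular functions on `O` and those
on `P`. -/
def boxAlgebra (S : FnStr X) (T : FnStr Y) (O : Set X) (P : Set Y) : Subalgebra ℂ (X × Y → ℂ) :=
  Algebra.adjoin ℂ
    ({F | ∃ f : X → ℂ, (∀ x ∈ O, S.RegularAt f x) ∧ F = fun z => f z.1} ∪
      {F | ∃ g : Y → ℂ, (∀ y ∈ P, T.RegularAt g y) ∧ F = fun z => g z.2})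

/-- The product: regular functions on `X × Y` are locally of the form `(∑ fᵢ gᵢ) / (∑ f'ⱼ g'ⱼ)`
with `fᵢ, f'ⱼ` regular on an open subset of `X` and `gᵢ, g'ⱼ` regular on an open subset of `Y`, and
the nonvanishing loci of the denominators form a basis of the topology. -/
def prod (S : FnStr X) (T : FnStr Y) : FnStr (X × Y) :=
  generate (ι := {O : Set X // IsOpen[S.top] O} × {P : Set Y // IsOpen[T.top] P})
    (fun i => i.1.1 ×ˢ i.2.1) (fun i => boxAlgebra S T i.1.1 i.2.1)
    (fun _ => ⟨(⟨Set.univ, @isOpen_univ _ S.top⟩, ⟨Set.univ, @isOpen_univ _ T.top⟩), by simp⟩)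
    (fun i j => ⟨(⟨i.1.1 ∩ j.1.1, S.top.isOpen_inter _ _ i.1.2 j.1.2⟩,
        ⟨i.2.1 ∩ j.2.1, T.top.isOpen_inter _ _ i.2.2 j.2.2⟩), by
      refine ⟨Set.prod_inter_prod.symm, Algebra.adjoin_mono (Set.union_subset_union ?_ ?_),
        Algebra.adjoin_mono (Set.union_subset_union ?_ ?_)⟩
      · rintro _ ⟨f, hf, rfl⟩
        exact ⟨f, fun x hx => hf x hx.1, rfl⟩
      · rintro _ ⟨f, hf, rfl⟩
        exact ⟨f, fun x hx => hf x hx.1, rfl⟩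
      · rintro _ ⟨f, hf, rfl⟩
        exact ⟨f, fun x hx => hf x hx.2, rfl⟩
      · rintro _ ⟨f, hf, rfl⟩
        exact ⟨f, fun x hx => hf x hx.2, rfl⟩⟩)

/-- `X` is an affine variety: it is isomorphic to a Zariski closed subset of some `ℂ ^ N`. -/
def IsAffineVariety (S : FnStr X) : Prop :=
  ∃ (N : ℕ) (Z : Set (Fin N → ℂ)), IsClosed[(affine (Fin N → ℂ)).top] Z ∧
    ∃ e : X ≃ Z, S.IsIsomorphism ((affine (Fin N → ℂ)).restrict Z) e

/-- `X` is a variety: it has a finite cover by open affine varieties, and it is separated. -/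
def IsVariety (S : FnStr X) : Prop :=
  (∃ (k : ℕ) (O : Fin k → Set X), (∀ i, IsOpen[S.top] (O i)) ∧ (⋃ i, O i) = Set.univ ∧
      ∀ i, (S.restrict (O i)).IsAffineVariety) ∧
    IsClosed[(S.prod S).top] (Set.diagonal X)

/-- The local ring at `x`: the germs at `x` of the functions that are regular at `x`. -/
def localRing (S : FnStr X) (x : X) : Subring ((@nhds X S.top x).Germ ℂ) where
  carrier := {g | ∃ f : X → ℂ, S.RegularAt f x ∧ g = (f : (@nhds X S.top x).Germ ℂ)}
  mul_mem' := by
    rintro _ _ ⟨f, hf, rfl⟩ ⟨g, hg, rfl⟩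
    exact ⟨_, S.mul' hf hg, rfl⟩
  one_mem' := ⟨_, S.const' 1 x, rfl⟩
  add_mem' := by
    rintro _ _ ⟨f, hf, rfl⟩ ⟨g, hg, rfl⟩
    exact ⟨_, S.add' hf hg, rfl⟩
  zero_mem' := ⟨_, S.const' 0 x, rfl⟩
  neg_mem' := by
    rintro _ ⟨f, hf, rfl⟩
    refine ⟨_, S.mul' (S.const' (-1) x) hf, ?_⟩
    rw [← Filter.Germ.coe_neg]
    congr 1
    funext y
    simp

/-- `X` is smooth of (pure) dimension `d`: it is non-empty and all its local rings are regular of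
Krull dimension `d`. -/
def IsSmoothOfDimension (S : FnStr X) (d : ℕ) : Prop :=
  Nonempty X ∧ ∀ x : X, IsRegularLocalRing (S.localRing x) ∧ ringKrullDim (S.localRing x) = d

/-! ### Families of vector spaces and the tensor product of vector bundles -/

/-- A regular frame, over an open set `base`, of a family of vector spaces `E x` (`x ∈ X`) whose
total space carries the structure `T`: a basis of each `E x` with `x ∈ base`, whose members are
regular sections. (Regular frames of a vector bundle are the same as its local trivializations.) -/
structure RegularFrame (S : FnStr X) (E : X → Type*) [∀ x, AddCommGroup (E x)]
    [∀ x, Module ℂ (E x)] (T : FnStr (Σ x, E x)) where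
  base : Set X
  isOpen_base : IsOpen[S.top] base
  rank : ℕ
  basis : (x : base) → Module.Basis (Fin rank) ℂ (E x)
  regular : ∀ i, (S.restrict base).IsMorphism T (fun x => ⟨x, basis x i⟩)

/-- The total space of the tensor product `E ⊗ F` of two vector bundles over `X`. Its structure is
the one for which regular frames `(eᵢ)` of `E` and `(fⱼ)` of `F` over open sets `O` and `P` give the
local trivialization `(x, c) ↦ ∑ cᵢⱼ eᵢ(x) ⊗ fⱼ(x)` over `O ∩ P`. -/
noncomputable def tensorBundle (S : FnStr X) (E F : X → Type*)
    [∀ x, AddCommGroup (E x)] [∀ x, Module ℂ (E x)]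
    [∀ x, AddCommGroup (F x)] [∀ x, Module ℂ (F x)]
    (TE : FnStr (Σ x, E x)) (TF : FnStr (Σ x, F x)) : FnStr (Σ x, E x ⊗[ℂ] F x) :=
  final (ι := RegularFrame S E TE × RegularFrame S F TF)
    (Y := fun i => ↥(i.1.base ∩ i.2.base) × (Fin i.1.rank → Fin i.2.rank → ℂ))
    (fun i => (S.restrict (i.1.base ∩ i.2.base)).prod
      (affine (Fin i.1.rank → Fin i.2.rank → ℂ)))
    (fun i z => ⟨z.1.1, ∑ a, ∑ b,
      z.2 a b • (i.1.basis ⟨z.1.1, z.1.2.1⟩ a ⊗ₜ[ℂ] i.2.basis ⟨z.1.1, z.1.2.2⟩ b)⟩)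

end FnStr

/-! ### Grassmannians, null cones -/

section NullCone

variable (V : Type*) [AddCommGroup V] [Module ℂ V]

/-- The Grassmannian of `r`-dimensional subspaces of `V`. -/
def Gr (r : ℕ) : Type _ := {U : Submodule ℂ V // Module.finrank ℂ U = r}

/-- The Stiefel variety of `r`-frames (linearly independent `r`-tuples) in `V`. -/
def Stiefel (r : ℕ) : Set (Fin r → V) := {v | LinearIndependent ℂ v}

/-- The span of an `r`-frame. -/
def Stiefel.span (r : ℕ) (v : Stiefel V r) : Gr V r :=
  ⟨Submodule.span ℂ (Set.range v.1), by
    rw [finrank_span_eq_card (show LinearIndependent ℂ v.1 from v.2), Fintype.card_fin]⟩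

/-- The Grassmannian as the quotient of the Stiefel variety (open in the affine space `V ^ r`) by
`GL_r`: a subset is open, and a function on it is regular, when its pullback to the Stiefel variety
is. -/
def Gr.str (r : ℕ) : FnStr (Gr V r) :=
  FnStr.final (ι := Unit) (fun _ => (FnStr.affine (Fin r → V)).restrict (Stiefel V r))
    (fun _ => Stiefel.span V r)

variable {V}

/-- The isotropic Grassmannian `J_r(V)`, a subset of the Grassmannian. -/
def IsotropicGr (B : LinearMap.BilinForm ℂ V) (r : ℕ) : Set (Gr V r) :=
  {U | ∀ u ∈ U.1, ∀ v ∈ U.1, B u v = 0}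

/-- The variety structure of `J_r(V)`. -/
def IsotropicGr.str (B : LinearMap.BilinForm ℂ V) (r : ℕ) : FnStr (IsotropicGr B r) :=
  (Gr.str V r).restrict (IsotropicGr B r)

/-- The map `Q` that sends `T : ℂ ^ m → V` to the matrix of the `(T eᵢ, T eⱼ)`. -/
def quadraticMap (B : LinearMap.BilinForm ℂ V) {m : ℕ} (T : (Fin m → ℂ) →ₗ[ℂ] V) :
    Matrix (Fin m) (Fin m) ℂ :=
  Matrix.of fun i j => B (T (Pi.single i 1)) (T (Pi.single j 1))

/-- The null cone `NCQ = Q⁻¹(0)` in `Hom(ℂ ^ m, V)`. -/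
def NCQ (B : LinearMap.BilinForm ℂ V) (m : ℕ) : Set ((Fin m → ℂ) →ₗ[ℂ] V) :=
  {T | quadraticMap B T = 0}

/-- The variety structure of `NCQ`. -/
def NCQ.str (B : LinearMap.BilinForm ℂ V) (m : ℕ) : FnStr (NCQ B m) :=
  (FnStr.affine ((Fin m → ℂ) →ₗ[ℂ] V)).restrict (NCQ B m)

/-- The pairs `(T, U)` in `NCQ × J_r(V)` such that the image of `T` is contained in `U`. -/
def NCQTilde (B : LinearMap.BilinForm ℂ V) (m r : ℕ) : Set (NCQ B m × IsotropicGr B r) :=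
  {p | LinearMap.range p.1.1 ≤ p.2.1.1}

/-- The variety structure of `NCQTilde`, as a subset of the product `NCQ × J_r(V)`. -/
def NCQTilde.str (B : LinearMap.BilinForm ℂ V) (m r : ℕ) : FnStr (NCQTilde B m r) :=
  ((NCQ.str B m).prod (IsotropicGr.str B r)).restrict (NCQTilde B m r)

/-- The fibres of the tautological bundle over `J_r(V)`. -/
abbrev Taut (B : LinearMap.BilinForm ℂ V) (r : ℕ) (U : IsotropicGr B r) : Type _ := ↥(U.1.1)

/-- The total space of the tautological bundle, identified with the set of all `(u, U)` in
`V × J_r(V)` with `u ∈ U`. -/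
def Taut.str (B : LinearMap.BilinForm ℂ V) (r : ℕ) : FnStr (Σ U : IsotropicGr B r, Taut B r U) :=
  ((FnStr.affine V).prod (IsotropicGr.str B r)).comap fun p => ((p.2 : V), p.1)

/-- The fibres of the trivial bundle of rank `m` over `J_r(V)`. -/
abbrev Triv (B : LinearMap.BilinForm ℂ V) (r m : ℕ) (_ : IsotropicGr B r) : Type := Fin m → ℂ

/-- The total space of the trivial bundle, identified with `ℂ ^ m × J_r(V)`. -/
def Triv.str (B : LinearMap.BilinForm ℂ V) (r m : ℕ) :
    FnStr (Σ U : IsotropicGr B r, Triv B r m U) :=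
  ((FnStr.affine (Fin m → ℂ)).prod (IsotropicGr.str B r)).comap fun p => (p.2, p.1)

/-- The total space of the vector bundle `Taut ⊗ ℂ ^ m` over `J_r(V)`. -/
abbrev TautTensor (B : LinearMap.BilinForm ℂ V) (r m : ℕ) : Type _ :=
  Σ U : IsotropicGr B r, Taut B r U ⊗[ℂ] Triv B r m U

/-- The structure of the total space of `Taut ⊗ ℂ ^ m`. -/
noncomputable def TautTensor.str (B : LinearMap.BilinForm ℂ V) (r m : ℕ) :
    FnStr (TautTensor B r m) :=
  (IsotropicGr.str B r).tensorBundle (Taut B r) (Triv B r m) (Taut.str B r) (Triv.str B r m)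

end NullCone

/-! A homomorphism from `ℂ ^ m` to an isotropic subspace `U` automatically lies in the null cone, so
a point over `U` is just an element of `Hom(ℂ ^ m, U) = U ⊗ ℂ ^ m`. This gives the fibrewise linear
bijection `tautTensorEquiv`, and only regularity in both directions has to be proved. Regularity is
local. For linear `p : V → ℂ ^ r`, each `U` mapped isomorphically by `p` has a unique basis lying
over the standard basis. By Cramer's rule this basis depends regularly on `U`
(`Gr.morphismAt_frame`). In it the bijection reads off the coordinates of the vectors `p (T e_b)`
(`isMorphism_tautTensorEquiv`). The inverse is a bilinear formula in any pair of regular frames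
(`isMorphism_tautTensorEquiv_symm`).

Smoothness comes from explicit charts (`DualFrames.chart`). Write the symmetry of the form as `(x,
y) = ε (y, x)` with `ε = ±1`, which treats both cases at once. A basis `u` of an isotropic `U` has a
dual frame `w` spanning another isotropic subspace, and `V = ⟨u⟩ ⊕ ⟨w⟩ ⊕ E` with `E` orthogonal to
both frames. An isotropic subspace transverse to `⟨w⟩ ⊕ E` has a unique basis `u_i + ∑ c_ij w_j +
x_i` with `x_i ∈ E`. After the substitution `a_ij = c_ij + (ε/2)(x_i, x_j)`, isotropy becomes the
linear condition `aᵀ = -ε a`. Together with the `m r` coordinates of `T`, this identifies an open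
set with a vector space. The local rings are therefore those of an affine space, that is, polynomial
rings localized at points (`Chart.localRing_regular`), and the dimension is found by counting
parameters.

The resolution is a variety because it is covered by such charts, is quasi-compact as the image of a
subset of a vector space, and has a closed diagonal (`isVariety_of_charts`). It is non-empty by
`exists_isotropic_frame`. -/

namespace FnStr

open Filter

/-! ### Morphisms as a condition at each point -/

variable {X Y Z : Type*}

/-- The neighbourhood filter of a point of a space with functions. -/
abbrev nhd (S : FnStr X) (x : X) : Filter X := @nhds X S.top x

/-- `f` is a morphism near `x`: it is continuous at `x`, and it pulls functions that are regular at
`f x` back to functions that are regular at `x`. -/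
def MorphismAt (S : FnStr X) (T : FnStr Y) (f : X → Y) (x : X) : Prop :=
  Tendsto f (S.nhd x) (T.nhd (f x)) ∧
    ∀ g : Y → ℂ, T.RegularAt g (f x) → S.RegularAt (fun y => g (f y)) x

theorem isMorphism_iff {S : FnStr X} {T : FnStr Y} {f : X → Y} :
    S.IsMorphism T f ↔ ∀ x, S.MorphismAt T f x := by
  let _ := S.top
  let _ := T.top
  have h : (∀ O : Set Y, IsOpen O → IsOpen (f ⁻¹' O)) ↔ ∀ x, Tendsto f (𝓝 x) (𝓝 (f x)) := by
    rw [← continuous_def, continuous_iff_continuousAt]; rfl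
  refine ⟨fun H x => ⟨h.1 H.1 x, fun g hg => H.2 g x hg⟩,
    fun H => ⟨h.2 fun x => (H x).1, fun g x hg => (H x).2 g hg⟩⟩

theorem MorphismAt.comp {S : FnStr X} {T : FnStr Y} {R : FnStr Z} {f : X → Y} {g : Y → Z} {x : X}
    (hg : T.MorphismAt R g (f x)) (hf : S.MorphismAt T f x) :
    S.MorphismAt R (fun y => g (f y)) x :=
  ⟨hg.1.comp hf.1, fun k hk => hf.2 _ (hg.2 k hk)⟩

theorem MorphismAt.congr {S : FnStr X} {T : FnStr Y} {f g : X → Y} {x : X}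
    (hf : S.MorphismAt T f x) (h : ∀ᶠ y in S.nhd x, f y = g y) : S.MorphismAt T g x := by
  let _ := S.top
  have hx : f x = g x := h.self_of_nhds
  refine ⟨hx ▸ hf.1.congr' h, fun k hk => ?_⟩
  refine S.congr' ?_ (hf.2 k (hx ▸ hk))
  filter_upwards [h] with y hy using by rw [hy]

theorem MorphismAt.id (S : FnStr X) (x : X) : S.MorphismAt S (fun y => y) x :=
  ⟨tendsto_id, fun _ h => h⟩

theorem eventually_of_isOpen (S : FnStr X) {O : Set X} (hO : IsOpen[S.top] O) {x : X} (hx : x ∈ O) :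
    ∀ᶠ y in S.nhd x, y ∈ O := by
  let _ := S.top
  exact hO.mem_nhds hx

theorem isOpen_of_eventually (S : FnStr X) {O : Set X} (h : ∀ x ∈ O, ∀ᶠ y in S.nhd x, y ∈ O) :
    IsOpen[S.top] O := by
  let _ := S.top
  exact isOpen_iff_mem_nhds.2 h

/-! ### Algebra of regular functions -/

/-- The algebra of the functions that are regular at `x`. -/
def regularAlgebra (S : FnStr X) (x : X) : Subalgebra ℂ (X → ℂ) where
  carrier := {f | S.RegularAt f x}
  mul_mem' := S.mul'
  add_mem' := S.add'
  algebraMap_mem' c := S.const' c x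

theorem mem_regularAlgebra {S : FnStr X} {x : X} {f : X → ℂ} :
    f ∈ S.regularAlgebra x ↔ S.RegularAt f x := Iff.rfl

section algebra

variable {S : FnStr X} {x : X} {f g : X → ℂ}

theorem RegularAt.add (hf : S.RegularAt f x) (hg : S.RegularAt g x) :
    S.RegularAt (fun y => f y + g y) x := S.add' hf hg

theorem RegularAt.mul (hf : S.RegularAt f x) (hg : S.RegularAt g x) :
    S.RegularAt (fun y => f y * g y) x := S.mul' hf hg

theorem RegularAt.sub (hf : S.RegularAt f x) (hg : S.RegularAt g x) :
    S.RegularAt (fun y => f y - g y) x := (S.regularAlgebra x).sub_mem hf hg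

theorem RegularAt.div (hf : S.RegularAt f x) (hg : S.RegularAt g x) (h : g x ≠ 0) :
    S.RegularAt (fun y => f y / g y) x := by
  simp only [div_eq_mul_inv]
  exact hf.mul (S.inv' hg h)

theorem RegularAt.sum {ι : Type*} (s : Finset ι) {F : ι → X → ℂ}
    (h : ∀ i ∈ s, S.RegularAt (F i) x) : S.RegularAt (fun y => ∑ i ∈ s, F i y) x := by
  have := (S.regularAlgebra x).sum_mem h
  rw [mem_regularAlgebra] at this
  convert this using 2
  simp

theorem RegularAt.prod {ι : Type*} (s : Finset ι) {F : ι → X → ℂ}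
    (h : ∀ i ∈ s, S.RegularAt (F i) x) : S.RegularAt (fun y => ∏ i ∈ s, F i y) x := by
  have := (S.regularAlgebra x).prod_mem h
  rw [mem_regularAlgebra] at this
  convert this using 2
  simp

theorem RegularAt.det {ι : Type*} [Fintype ι] [DecidableEq ι] {M : X → Matrix ι ι ℂ}
    (h : ∀ i j, S.RegularAt (fun y => M y i j) x) : S.RegularAt (fun y => (M y).det) x := by
  simp only [Matrix.det_apply']
  exact RegularAt.sum _ fun σ _ => (S.const' _ x).mul (RegularAt.prod _ fun i _ => h _ _)

theorem RegularAt.matrix_inv {ι : Type*} [Fintype ι] [DecidableEq ι] {M : X → Matrix ι ι ℂ}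
    (h : ∀ i j, S.RegularAt (fun y => M y i j) x) (h0 : (M x).det ≠ 0) (i j : ι) :
    S.RegularAt (fun y => (M y)⁻¹ i j) x := by
  have : (fun y => (M y)⁻¹ i j) = fun y => ((M y).det)⁻¹ * (M y).adjugate i j := by
    funext y
    rw [Matrix.inv_def, Ring.inverse_eq_inv', Matrix.smul_apply, smul_eq_mul]
  rw [this]
  refine (S.inv' (RegularAt.det h) h0).mul ?_
  simp only [Matrix.adjugate_apply]
  refine RegularAt.det fun k l => ?_
  by_cases hk : k = j
  · subst hk
    simpa using! S.const' _ x
  · simpa [Matrix.updateRow_ne hk] using! h k l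

end algebra

/-! ### Induced structures -/

theorem comap_nhd (S : FnStr X) (i : Y → X) (y : Y) :
    (S.comap i).nhd y = (S.nhd (i y)).comap i :=
  @nhds_induced X Y S.top i y

theorem morphismAt_comap (S : FnStr X) (i : Y → X) (y : Y) : (S.comap i).MorphismAt S i y := by
  refine ⟨?_, fun g hg => ⟨g, hg, Eventually.of_forall fun _ => rfl⟩⟩
  rw [comap_nhd]
  exact tendsto_comap

theorem morphismAt_restrict (S : FnStr X) {O : Set X} (x : O) :
    (S.restrict O).MorphismAt S (fun y => y.1) x :=
  morphismAt_comap S _ x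

/-- Universal property of the induced structure: its germs are pulled back from the ambient space,
so regularity may be tested there. -/
theorem MorphismAt.codomain_comap {S : FnStr X} {T : FnStr Y} {i : Z → Y} {f : X → Z} {x : X}
    (h : S.MorphismAt T (fun y => i (f y)) x) : S.MorphismAt (T.comap i) f x := by
  have h1 : Tendsto f (S.nhd x) ((T.comap i).nhd (f x)) := by
    rw [comap_nhd, tendsto_comap_iff]
    exact h.1
  refine ⟨h1, fun g ⟨F, hF, hg⟩ => ?_⟩
  refine S.congr' ?_ (h.2 F hF)
  filter_upwards [h1.eventually hg] with y hy using hy.symm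

/-- A neighbourhood inside an open set is a neighbourhood in the whole space, so restricting to an
open set loses no information about germs. -/
theorem regularAt_of_restrict {S : FnStr X} {O : Set X} (hO : IsOpen[S.top] O) {f : X → ℂ} {x : O}
    (h : (S.restrict O).RegularAt (fun y => f y) x) : S.RegularAt f x := by
  obtain ⟨F, hF, hf⟩ := h
  change ∀ᶠ z in (S.comap (Subtype.val : O → X)).nhd x, _ at hf
  rw [comap_nhd, eventually_comap] at hf
  refine S.congr' ?_ hF
  filter_upwards [hf, S.eventually_of_isOpen hO x.2] with y hy hyO using (hy ⟨y, hyO⟩ rfl).symm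

theorem MorphismAt.of_restrict {S : FnStr X} {T : FnStr Y} {O : Set X} (hO : IsOpen[S.top] O)
    {f : X → Y} {x : O} (h : (S.restrict O).MorphismAt T (fun y => f y) x) :
    S.MorphismAt T f x := by
  refine ⟨fun N hN => ?_, fun g hg => regularAt_of_restrict hO (h.2 g hg)⟩
  have h1 := h.1 hN
  change _ ∈ (S.comap (Subtype.val : O → X)).nhd x at h1
  rw [comap_nhd, mem_comap] at h1
  obtain ⟨t, ht, hs⟩ := h1
  rw [mem_map]
  filter_upwards [ht, S.eventually_of_isOpen hO x.2] with y hy hyO using hs (a := ⟨y, hyO⟩) hy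

/-! ### Generated structures -/

section generate

variable {ι : Type*} {D : ι → Set X} {A : ι → Subalgebra ℂ (X → ℂ)}
    {cover : ∀ x, ∃ i, x ∈ D i} {inter : ∀ i j, ∃ k, D k = D i ∩ D j ∧ A i ≤ A k ∧ A j ≤ A k}

theorem eventually_generate_iff {P : X → Prop} {x : X} :
    (∀ᶠ y in (generate D A cover inter).nhd x, P y) ↔
      ∃ i, ∃ b ∈ A i, x ∈ D i ∧ b x ≠ 0 ∧ ∀ y ∈ D i, b y ≠ 0 → P y := by
  rw [nhd, eventually_iff]
  constructor
  · rintro ⟨O, hP, hO, hx⟩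
    obtain ⟨i, b, hb, hi, hbx, h⟩ := hO x hx
    exact ⟨i, b, hb, hi, hbx, fun y hy h0 => hP y (h y hy h0)⟩
  · rintro ⟨i, b, hb, hi, hbx, h⟩
    exact ⟨{y | y ∈ D i ∧ b y ≠ 0}, fun y hy => h y hy.1 hy.2,
      fun _ hy => ⟨i, b, hb, hy.1, hy.2, fun _ hz hz0 => ⟨hz, hz0⟩⟩, ⟨hi, hbx⟩⟩

theorem regularAt_generate {i : ι} {a : X → ℂ} (ha : a ∈ A i) {x : X} (hx : x ∈ D i) :
    (generate D A cover inter).RegularAt a x :=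
  ⟨i, a, ha, 1, one_mem _, hx, by simp, fun y _ _ => by simp⟩

/-- Open sets and regular functions are built locally from quotients of generators, and nonvanishing
and quotients pull back well; hence only the algebras `A i` need testing. -/
theorem MorphismAt.codomain_generate {S : FnStr Y} {f : Y → X} {y : Y}
    (h : ∀ i, f y ∈ D i → (∀ᶠ z in S.nhd y, f z ∈ D i) ∧
      ∀ a ∈ A i, S.RegularAt (fun z => a (f z)) y) :
    S.MorphismAt (generate D A cover inter) f y := by
  constructor
  · intro N hN
    obtain ⟨i, b, hb, hi, hbx, hN⟩ := eventually_generate_iff.1 hN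
    obtain ⟨h1, h2⟩ := h i hi
    rw [mem_map]
    filter_upwards [h1, S.ne_zero' (h2 b hb) hbx] with z hz hz0 using hN _ hz hz0
  · rintro g ⟨i, a, ha, b, hb, hi, hbx, hg⟩
    obtain ⟨h1, h2⟩ := h i hi
    refine S.congr' ?_ ((h2 a ha).div (h2 b hb) hbx)
    filter_upwards [h1, S.ne_zero' (h2 b hb) hbx] with z hz hz0 using (hg _ hz hz0).symm

end generate

/-! ### Affine spaces -/

section affine

variable {W W' : Type*} [AddCommGroup W] [Module ℂ W] [AddCommGroup W'] [Module ℂ W']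

theorem regularAt_linear (φ : Module.Dual ℂ W) (x : W) : (affine W).RegularAt φ x :=
  by
  refine regularAt_generate (i := ()) ?_ trivial
  exact Algebra.subset_adjoin ⟨φ, rfl⟩

/-- The functions with regular pullback form an algebra, so it suffices to test the linear forms,
which generate the polynomial functions. This reduces every map to a vector space to its
coordinates. -/
theorem MorphismAt.codomain_affine {S : FnStr X} {f : X → W} {x : X}
    (h : ∀ φ : Module.Dual ℂ W, S.RegularAt (fun y => φ (f y)) x) :
    S.MorphismAt (affine W) f x := by
  refine MorphismAt.codomain_generate fun _ _ => ⟨Eventually.of_forall fun _ => trivial, ?_⟩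
  intro a ha
  let ψ : (W → ℂ) →ₐ[ℂ] (X → ℂ) :=
    { toFun := fun a y => a (f y), map_one' := rfl, map_mul' := fun _ _ => rfl, map_zero' := rfl,
      map_add' := fun _ _ => rfl, commutes' := fun _ => rfl }
  have : polynomialFunctions W ≤ (S.regularAlgebra x).comap ψ := by
    refine Algebra.adjoin_le ?_
    rintro _ ⟨φ, rfl⟩
    exact h φ
  exact this ha

theorem MorphismAt.regularAt_linear {S : FnStr X} {f : X → W} {x : X}
    (h : S.MorphismAt (affine W) f x) (φ : Module.Dual ℂ W) : S.RegularAt (fun y => φ (f y)) x :=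
  h.2 _ (FnStr.regularAt_linear φ _)

theorem morphismAt_linear (f : W →ₗ[ℂ] W') (x : W) : (affine W).MorphismAt (affine W') f x :=
  .codomain_affine fun φ => FnStr.regularAt_linear (φ.comp f) x

theorem MorphismAt.linear_comp {S : FnStr X} {f : X → W} {x : X}
    (h : S.MorphismAt (affine W) f x) (g : W →ₗ[ℂ] W') :
    S.MorphismAt (affine W') (fun y => g (f y)) x :=
  (morphismAt_linear g _).comp h

theorem MorphismAt.of_injective {S : FnStr X} {f : X → W} {x : X} (g : W →ₗ[ℂ] W')
    (hg : Function.Injective g) (h : S.MorphismAt (affine W') (fun y => g (f y)) x) :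
    S.MorphismAt (affine W) f x := by
  obtain ⟨k, hk⟩ := g.exists_leftInverse_of_injective (LinearMap.ker_eq_bot.2 hg)
  have := h.linear_comp k
  simpa only [← LinearMap.comp_apply, hk, LinearMap.id_apply] using this

theorem MorphismAt.codomain_pi {S : FnStr X} {ι : Type*} [Finite ι] {f : X → ι → W} {x : X}
    (h : ∀ i, S.MorphismAt (affine W) (fun y => f y i) x) :
    S.MorphismAt (affine (ι → W)) f x := by
  classical
  have := Fintype.ofFinite ι
  refine .codomain_affine fun φ => ?_
  have : (fun y => φ (f y)) = fun y => ∑ i, φ.comp (LinearMap.single ℂ (fun _ => W) i) (f y i) := by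
    funext y
    conv_lhs => rw [← Finset.univ_sum_single (f y)]
    simp
  rw [this]
  exact RegularAt.sum _ fun i _ => (h i).regularAt_linear _

theorem MorphismAt.codomain_prod {S : FnStr X} {f : X → W} {g : X → W'} {x : X}
    (hf : S.MorphismAt (affine W) f x) (hg : S.MorphismAt (affine W') g x) :
    S.MorphismAt (affine (W × W')) (fun y => (f y, g y)) x := by
  refine .codomain_affine fun φ => ?_
  have := (hf.regularAt_linear (φ ∘ₗ LinearMap.inl ℂ W W')).add
    (hg.regularAt_linear (φ ∘ₗ LinearMap.inr ℂ W W'))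
  simpa only [LinearMap.comp_apply, ← map_add, LinearMap.inl_apply, LinearMap.inr_apply,
    Prod.mk_add_mk, add_zero, zero_add] using this

theorem RegularAt.morphismAt {S : FnStr X} {f : X → ℂ} {x : X} (h : S.RegularAt f x) :
    S.MorphismAt (affine ℂ) f x := by
  refine .codomain_affine fun φ => ?_
  have : (fun y => φ (f y)) = fun y => f y * φ 1 := by
    funext y
    rw [← smul_eq_mul, ← map_smul, smul_eq_mul, mul_one]
  rw [this]
  exact h.mul (S.const' _ x)

theorem MorphismAt.add {S : FnStr X} {f g : X → W} {x : X} (hf : S.MorphismAt (affine W) f x)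
    (hg : S.MorphismAt (affine W) g x) : S.MorphismAt (affine W) (fun y => f y + g y) x :=
  .codomain_affine fun φ => by
    simpa only [map_add] using (hf.regularAt_linear φ).add (hg.regularAt_linear φ)

theorem MorphismAt.sub {S : FnStr X} {f g : X → W} {x : X} (hf : S.MorphismAt (affine W) f x)
    (hg : S.MorphismAt (affine W) g x) : S.MorphismAt (affine W) (fun y => f y - g y) x :=
  .codomain_affine fun φ => by
    simpa only [map_sub] using (hf.regularAt_linear φ).sub (hg.regularAt_linear φ)

theorem MorphismAt.smul {S : FnStr X} {f : X → ℂ} {g : X → W} {x : X} (hf : S.RegularAt f x)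
    (hg : S.MorphismAt (affine W) g x) : S.MorphismAt (affine W) (fun y => f y • g y) x :=
  .codomain_affine fun φ => by
    simpa only [map_smul, smul_eq_mul] using hf.mul (hg.regularAt_linear φ)

theorem MorphismAt.sum {S : FnStr X} {ι : Type*} (s : Finset ι) {f : ι → X → W} {x : X}
    (hf : ∀ i ∈ s, S.MorphismAt (affine W) (f i) x) :
    S.MorphismAt (affine W) (fun y => ∑ i ∈ s, f i y) x :=
  .codomain_affine fun φ => by
    simpa only [map_sum] using RegularAt.sum s fun i hi => (hf i hi).regularAt_linear φ

theorem MorphismAt.const (S : FnStr X) (w : W) (x : X) : S.MorphismAt (affine W) (fun _ => w) x :=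
  .codomain_affine fun _ => S.const' _ x

theorem MorphismAt.bilin [FiniteDimensional ℂ W] {S : FnStr X} (B : LinearMap.BilinForm ℂ W)
    {f g : X → W} {x : X} (hf : S.MorphismAt (affine W) f x) (hg : S.MorphismAt (affine W) g x) :
    S.RegularAt (fun y => B (f y) (g y)) x := by
  let b := Module.finBasis ℂ W
  have : (fun y => B (f y) (g y)) = fun y => ∑ i, b.coord i (f y) * B (b i) (g y) := by
    funext y
    conv_lhs => rw [← b.sum_repr (f y)]
    simp only [map_sum, map_smul, smul_eq_mul, LinearMap.sum_apply, LinearMap.smul_apply,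
      Module.Basis.coord_apply]
  rw [this]
  exact RegularAt.sum _ fun i _ => (hf.regularAt_linear _).mul (hg.regularAt_linear _)

end affine

/-! ### Products -/

section prod

variable {S : FnStr X} {T : FnStr Y}

theorem exists_isOpen_regular (S : FnStr X) {f : X → ℂ} {x : X} (h : S.RegularAt f x) :
    ∃ O, IsOpen[S.top] O ∧ x ∈ O ∧ ∀ y ∈ O, S.RegularAt f y := by
  obtain ⟨O, h1, h2, h3⟩ := (eventually_iff S.top).1 (S.eventually' h)
  exact ⟨O, h2, h3, h1⟩

theorem morphismAt_fst (S : FnStr X) (T : FnStr Y) (z : X × Y) :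
    (S.prod T).MorphismAt S Prod.fst z := by
  constructor
  · intro N hN
    obtain ⟨O, h1, h2, h3⟩ := (eventually_iff S.top).1 hN
    refine eventually_generate_iff.2 ⟨(⟨O, h2⟩, ⟨Set.univ, @isOpen_univ _ T.top⟩), 1, one_mem _,
      ⟨h3, trivial⟩, one_ne_zero, fun y hy _ => h1 _ hy.1⟩
  · intro g hg
    obtain ⟨O, h1, h2, h3⟩ := S.exists_isOpen_regular hg
    refine regularAt_generate (i := (⟨O, h1⟩, ⟨Set.univ, @isOpen_univ _ T.top⟩)) ?_ ?_
    · exact Algebra.subset_adjoin (Or.inl ⟨g, h3, rfl⟩)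
    · exact ⟨h2, trivial⟩

theorem morphismAt_snd (S : FnStr X) (T : FnStr Y) (z : X × Y) :
    (S.prod T).MorphismAt T Prod.snd z := by
  constructor
  · intro N hN
    obtain ⟨O, h1, h2, h3⟩ := (eventually_iff T.top).1 hN
    refine eventually_generate_iff.2 ⟨(⟨Set.univ, @isOpen_univ _ S.top⟩, ⟨O, h2⟩), 1, one_mem _,
      ⟨trivial, h3⟩, one_ne_zero, fun y hy _ => h1 _ hy.2⟩
  · intro g hg
    obtain ⟨O, h1, h2, h3⟩ := T.exists_isOpen_regular hg
    refine regularAt_generate (i := (⟨Set.univ, @isOpen_univ _ S.top⟩, ⟨O, h1⟩)) ?_ ?_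
    · exact Algebra.subset_adjoin (Or.inr ⟨g, h3, rfl⟩)
    · exact ⟨trivial, h2⟩

/-- Universal property of the product: a box algebra is generated by functions of one factor, and
these pull back through `f` or `g` alone. -/
theorem MorphismAt.prodMk {R : FnStr Z} {f : Z → X} {g : Z → Y} {z : Z} (hf : R.MorphismAt S f z)
    (hg : R.MorphismAt T g z) : R.MorphismAt (S.prod T) (fun y => (f y, g y)) z := by
  refine MorphismAt.codomain_generate ?_
  rintro ⟨⟨O, hO⟩, ⟨P, hP⟩⟩ ⟨h1, h2⟩
  refine ⟨?_, ?_⟩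
  · filter_upwards [hf.1.eventually (S.eventually_of_isOpen hO h1),
      hg.1.eventually (T.eventually_of_isOpen hP h2)] with y hy hy' using ⟨hy, hy'⟩
  · intro a ha
    let ψ : (X × Y → ℂ) →ₐ[ℂ] (Z → ℂ) :=
      { toFun := fun a y => a (f y, g y), map_one' := rfl, map_mul' := fun _ _ => rfl,
        map_zero' := rfl, map_add' := fun _ _ => rfl, commutes' := fun _ => rfl }
    have : boxAlgebra S T O P ≤ (R.regularAlgebra z).comap ψ := by
      refine Algebra.adjoin_le ?_
      rintro _ (⟨k, hk, rfl⟩ | ⟨k, hk, rfl⟩)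
      · exact hf.2 k (hk _ h1)
      · exact hg.2 k (hk _ h2)
    exact this ha

/-- The diagonal is closed when its complement is covered by nonvanishing loci of regular functions
that vanish on the diagonal. -/
theorem isClosed_diagonal {S : FnStr X}
    (h : ∀ x y, x ≠ y → ∃ F : X × X → ℂ, (S.prod S).RegularAt F (x, y) ∧ F (x, y) ≠ 0 ∧
      ∀ᶠ z in (S.prod S).nhd (x, y), z.1 = z.2 → F z = 0) :
    IsClosed[(S.prod S).top] (Set.diagonal X) := by
  let _ := (S.prod S).top
  rw [← isOpen_compl_iff]
  refine (S.prod S).isOpen_of_eventually ?_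
  rintro ⟨x, y⟩ hxy
  obtain ⟨F, hF, h0, hz⟩ := h x y hxy
  filter_upwards [(S.prod S).ne_zero' hF h0, hz] with z h1 h2 h3 using h1 (h2 h3)

end prod

/-! ### Final structures -/

section final

variable {ι : Type*} {E : ι → Type*} {S : ∀ i, FnStr (E i)} {p : ∀ i, E i → X}

theorem morphismAt_final (i : ι) (y : E i) : (S i).MorphismAt (final S p) (p i) y := by
  constructor
  · intro N hN
    obtain ⟨O, h1, h2, h3⟩ := (eventually_iff (final S p).top).1 hN
    filter_upwards [(S i).eventually_of_isOpen (h2 i) h3] with z hz using h1 _ hz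
  · rintro g ⟨O, hO, hx, hg⟩
    exact hg i y hx

theorem IsMorphism.of_final {T : FnStr Y} {f : X → Y}
    (h : ∀ i, (S i).IsMorphism T fun y => f (p i y)) : (final S p).IsMorphism T f := by
  refine ⟨fun O hO i => (h i).1 O hO, fun g x hg => ?_⟩
  obtain ⟨O, hO, hx, hOg⟩ := T.exists_isOpen_regular hg
  exact ⟨f ⁻¹' O, fun i => (h i).1 O hO, hx, fun i y hy => (h i).2 g y (hOg _ hy)⟩

end final

end FnStr

/-! ### The local rings of polynomial rings at points -/

namespace MvPolynomial

variable {ι : Type*}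

/-- The automorphism `p ↦ p(X + a)` of the polynomial ring. -/
noncomputable def translation (a : ι → ℂ) : MvPolynomial ι ℂ ≃ₐ[ℂ] MvPolynomial ι ℂ :=
  AlgEquiv.ofAlgHom (aeval fun i => X i + C (a i)) (aeval fun i => X i - C (a i))
    (by ext i; simp) (by ext i; simp)

theorem eval_translation (a x : ι → ℂ) (p : MvPolynomial ι ℂ) :
    eval x (translation a p) = eval (x + a) p := by
  have : ((aeval x).comp (translation a).toAlgHom : MvPolynomial ι ℂ →ₐ[ℂ] ℂ) = aeval (x + a) := by
    ext i
    simp [translation]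
  simpa [aeval_eq_eval] using DFunLike.congr_fun this p

/-- A translation of the polynomial ring carries one point to the other. -/
theorem height_ker_eval_eq (x y : ι → ℂ) :
    (RingHom.ker (eval x)).height = (RingHom.ker (eval y)).height := by
  rw [← (translation (y - x)).toRingEquiv.height_comap (RingHom.ker (eval x))]
  congr 1
  ext p
  rw [Ideal.mem_comap, RingHom.mem_ker, RingHom.mem_ker]
  have := eval_translation (y - x) x p
  rw [add_sub_cancel] at this
  exact Eq.congr_left this

instance isMaximal_ker_eval (x : ι → ℂ) : (RingHom.ker (eval x)).IsMaximal :=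
  RingHom.ker_isMaximal_of_surjective _ fun c => ⟨C c, eval_C c⟩

theorem height_ker_eval [Finite ι] (x : ι → ℂ) :
    ((RingHom.ker (eval x)).height : WithBot ℕ∞) = Nat.card ι := by
  have hdim : ringKrullDim (MvPolynomial ι ℂ) = Nat.card ι := by simp
  have : FiniteRingKrullDim (MvPolynomial ι ℂ) := by
    rw [finiteRingKrullDim_iff_ne_bot_and_top, hdim]
    exact ⟨WithBot.natCast_ne_bot _, 
      WithBot.coe_injective.ne (ENat.natCast_ne_top (Nat.card ι))⟩
  -- Some maximal ideal attains the Krull dimension. It is a point by the Nullstellensatz, and all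
  -- points have the same height.
  obtain ⟨I, hI, h⟩ := Ideal.exists_isMaximal_height (R := MvPolynomial ι ℂ)
  obtain ⟨y, rfl⟩ := isMaximal_iff_eq_vanishingIdeal_singleton.1 hI
  have hy : vanishingIdeal ℂ {y} = RingHom.ker (eval y) := by
    ext p
    simp [RingHom.mem_ker, aeval_eq_eval]
  rw [height_ker_eval_eq x y, ← hy, h, hdim]

end MvPolynomial

namespace FnStr

open Filter

variable {X Y : Type*}

/-! ### Functoriality of local rings -/

/-- The homomorphism of local rings induced by a morphism. -/
def localRingMap {S : FnStr X} {T : FnStr Y} {f : X → Y} {x : X} {y : Y} (hxy : f x = y)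
    (h : S.MorphismAt T f x) : T.localRing y →+* S.localRing x where
  toFun g := ⟨g.1.compTendsto f (hxy ▸ h.1), by
    obtain ⟨_, k, hk, rfl⟩ := g
    exact ⟨_, h.2 k (hxy ▸ hk), rfl⟩⟩
  map_one' := rfl
  map_zero' := rfl
  map_mul' := by
    rintro ⟨_, k, hk, rfl⟩ ⟨_, l, hl, rfl⟩
    rfl
  map_add' := by
    rintro ⟨_, k, hk, rfl⟩ ⟨_, l, hl, rfl⟩
    rfl

theorem localRingMap_localRingMap {S : FnStr X} {T : FnStr Y} {f : X → Y} {g : Y → X} {x : X}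
    {y : Y} (hxy : f x = y) (hyx : g y = x) (hf : S.MorphismAt T f x) (hg : T.MorphismAt S g y)
    (h : ∀ᶠ z in S.nhd x, g (f z) = z) (s : S.localRing x) :
    localRingMap hxy hf (localRingMap hyx hg s) = s := by
  obtain ⟨_, k, hk, rfl⟩ := s
  refine Subtype.ext (Filter.Germ.coe_eq.2 ?_)
  filter_upwards [h] with z hz
  simp [hz]

/-- Local rings at points that correspond to each other under a local isomorphism are isomorphic. -/
def localRingEquiv {S : FnStr X} {T : FnStr Y} {f : X → Y} {g : Y → X} {x : X}
    {y : Y} (hxy : f x = y) (hyx : g y = x) (hf : S.MorphismAt T f x) (hg : T.MorphismAt S g y)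
    (h : ∀ᶠ z in S.nhd x, g (f z) = z) (h' : ∀ᶠ z in T.nhd y, f (g z) = z) :
    T.localRing y ≃+* S.localRing x :=
  RingEquiv.ofRingHom (localRingMap hxy hf) (localRingMap hyx hg)
    (RingHom.ext (localRingMap_localRingMap hxy hyx hf hg h))
    (RingHom.ext (localRingMap_localRingMap hyx hxy hg hf h'))

/-! ### Local rings of affine spaces -/

section affine

variable {ι : Type*} [Finite ι]

theorem mem_polynomialFunctions {a : (ι → ℂ) → ℂ} :
    a ∈ polynomialFunctions (ι → ℂ) ↔
      ∃ p : MvPolynomial ι ℂ, a = fun x => MvPolynomial.eval x p := by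
  classical
  have := Fintype.ofFinite ι
  let ψ : MvPolynomial ι ℂ →ₐ[ℂ] ((ι → ℂ) → ℂ) := MvPolynomial.aeval fun i x => x i
  have hψ : ∀ p, ψ p = fun x => MvPolynomial.eval x p := by
    intro p
    funext x
    have : (Pi.evalAlgHom ℂ (fun _ : ι → ℂ => ℂ) x).comp ψ = MvPolynomial.aeval x := by
      ext i
      simp [ψ]
    simpa [MvPolynomial.aeval_eq_eval] using DFunLike.congr_fun this p
  constructor
  · intro ha
    have h : polynomialFunctions (ι → ℂ) ≤ ψ.range := by
      refine Algebra.adjoin_le ?_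
      rintro _ ⟨φ, rfl⟩
      refine ⟨∑ i, MvPolynomial.C (φ (Pi.single i 1)) * MvPolynomial.X i, ?_⟩
      rw [AlgHom.toRingHom_eq_coe, RingHom.coe_coe, hψ]
      funext x
      conv_rhs => rw [← Finset.univ_sum_single x]
      have h (i : ι) : φ (Pi.single i (x i)) = x i * φ (Pi.single i 1) := by
        rw [← smul_eq_mul, ← map_smul, ← Pi.single_smul, smul_eq_mul, mul_one]
      simp only [map_sum, h]
      simp [mul_comm]
    obtain ⟨p, hp⟩ := h ha
    exact ⟨p, by rw [← hψ]; exact hp.symm⟩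
  · rintro ⟨p, rfl⟩
    rw [← hψ]
    induction p using MvPolynomial.induction_on with
    | C c =>
      rw [MvPolynomial.algHom_C]
      exact (polynomialFunctions (ι → ℂ)).algebraMap_mem c
    | add p q hp hq => rw [map_add]; exact add_mem hp hq
    | mul_X p i hp =>
      rw [map_mul]
      refine mul_mem hp (Algebra.subset_adjoin ⟨LinearMap.proj i, ?_⟩)
      funext x
      simp [ψ]

/-- The germ of a polynomial. -/
noncomputable def polynomialGerm (x : ι → ℂ) :
    MvPolynomial ι ℂ →+* (affine (ι → ℂ)).localRing x where
  toFun p := ⟨((fun y => MvPolynomial.eval y p : (ι → ℂ) → ℂ) : (@nhds _ (affine (ι → ℂ)).top x).Germ ℂ),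
    _, regularAt_generate (i := ()) (mem_polynomialFunctions.2 ⟨p, rfl⟩) trivial, rfl⟩
  map_one' := Subtype.ext (by simp; rfl)
  map_zero' := Subtype.ext (by simp; rfl)
  map_mul' p q := Subtype.ext (by simp; rfl)
  map_add' p q := Subtype.ext (by simp; rfl)

theorem polynomialGerm_isLocalization (x : ι → ℂ) :
    letI := (polynomialGerm x).toAlgebra
    IsLocalization.AtPrime ((affine (ι → ℂ)).localRing x) (RingHom.ker (MvPolynomial.eval x)) := by
  let _ := (polynomialGerm x).toAlgebra
  have hreg : ∀ p : MvPolynomial ι ℂ,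
      (affine (ι → ℂ)).RegularAt (fun y => MvPolynomial.eval y p) x := fun p =>
    regularAt_generate (i := ()) (mem_polynomialFunctions.2 ⟨p, rfl⟩) trivial
  refine (isLocalization_iff _ _).2 ⟨?_, ?_, fun {p q} hpq => ?_⟩
  · rintro ⟨p, hp⟩
    have hp0 : MvPolynomial.eval x p ≠ 0 := hp
    refine IsUnit.of_mul_eq_one ⟨_, _, (affine (ι → ℂ)).inv' (hreg p) hp0, rfl⟩ ?_
    refine Subtype.ext (Filter.Germ.coe_eq.2 ?_)
    filter_upwards [(affine (ι → ℂ)).ne_zero' (hreg p) hp0] with y hy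
    exact mul_inv_cancel₀ hy
  · rintro ⟨_, f, ⟨i, a, ha, b, hb, -, hbx, hf⟩, rfl⟩
    obtain ⟨p, rfl⟩ := mem_polynomialFunctions.1 ha
    obtain ⟨q, rfl⟩ := mem_polynomialFunctions.1 hb
    refine ⟨(p, ⟨q, hbx⟩), Subtype.ext (Filter.Germ.coe_eq.2 ?_)⟩
    filter_upwards [(affine (ι → ℂ)).ne_zero' (hreg q) hbx] with y hy
    change f y * MvPolynomial.eval y q = MvPolynomial.eval y p
    rw [hf y trivial hy, div_mul_cancel₀ _ hy]
  · have h1 : ∀ᶠ y in (affine (ι → ℂ)).nhd x, MvPolynomial.eval y p = MvPolynomial.eval y q :=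
      Filter.Germ.coe_eq.1 (congrArg Subtype.val hpq)
    -- Equality of germs holds where some polynomial `c` with `c x ≠ 0` does not vanish. Hence `c p
    -- = c q` at every point, and so as polynomials.
    obtain ⟨-, b, hb, -, hbx, h⟩ := eventually_generate_iff.1 h1
    obtain ⟨c, rfl⟩ := mem_polynomialFunctions.1 hb
    refine ⟨⟨c, hbx⟩, MvPolynomial.funext fun y => ?_⟩
    rw [map_mul, map_mul]
    by_cases hy : MvPolynomial.eval y c = 0
    · simp [hy]
    · rw [h y trivial hy]

theorem affine_localRing_regular (x : ι → ℂ) :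
    IsRegularLocalRing ((affine (ι → ℂ)).localRing x) ∧
      ringKrullDim ((affine (ι → ℂ)).localRing x) = Nat.card ι := by
  let _ := (polynomialGerm x).toAlgebra
  have h := polynomialGerm_isLocalization x
  refine ⟨?_, ?_⟩
  · exact IsRegularLocalRing.of_ringEquiv (IsLocalization.algEquiv
      (RingHom.ker (MvPolynomial.eval x)).primeCompl
      (Localization.AtPrime (RingHom.ker (MvPolynomial.eval x)))
      ((affine (ι → ℂ)).localRing x)).toRingEquiv
  · rw [IsLocalization.AtPrime.ringKrullDim_eq_height (RingHom.ker (MvPolynomial.eval x)),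
      MvPolynomial.height_ker_eval]

end affine

/-! ### Charts with values in an affine space -/

/-- A space with functions is locally an affine space at `x`: an open neighbourhood of `x` is
isomorphic to the vector space `W`. -/
structure Chart (S : FnStr X) (x : X) (W : Type*) [AddCommGroup W] [Module ℂ W] where
  source : Set X
  isOpen_source : IsOpen[S.top] source
  mem_source : x ∈ source
  equiv : source ≃ W
  isIsomorphism : (S.restrict source).IsIsomorphism (affine W) equiv

/-- Charts may be composed with linear isomorphisms. -/
def Chart.trans {S : FnStr X} {x : X} {W W' : Type*} [AddCommGroup W] [Module ℂ W]
    [AddCommGroup W'] [Module ℂ W'] (c : S.Chart x W) (l : W ≃ₗ[ℂ] W') : S.Chart x W' where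
  source := c.source
  isOpen_source := c.isOpen_source
  mem_source := c.mem_source
  equiv := c.equiv.trans l.toEquiv
  isIsomorphism := by
    refine ⟨isMorphism_iff.2 fun y => ?_, isMorphism_iff.2 fun y => ?_⟩
    · exact (morphismAt_linear l.toLinearMap _).comp (isMorphism_iff.1 c.isIsomorphism.1 y)
    · exact (isMorphism_iff.1 c.isIsomorphism.2 _).comp (morphismAt_linear l.symm.toLinearMap y)

theorem Chart.isAffineVariety {S : FnStr X} {x : X} {W : Type*} [AddCommGroup W] [Module ℂ W]
    [FiniteDimensional ℂ W] (c : S.Chart x W) : (S.restrict c.source).IsAffineVariety := by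
  let c' := c.trans (Module.finBasis ℂ W).equivFun
  refine ⟨_, Set.univ, @isClosed_univ _ (affine _).top,
    c'.equiv.trans (Equiv.Set.univ _).symm, isMorphism_iff.2 fun y => ?_,
    isMorphism_iff.2 fun y => ?_⟩
  · exact .codomain_comap (isMorphism_iff.1 c'.isIsomorphism.1 y)
  · exact (isMorphism_iff.1 c'.isIsomorphism.2 _).comp (morphismAt_comap _ _ y)

theorem Chart.localRing_regular {S : FnStr X} {x : X} {W : Type*} [AddCommGroup W] [Module ℂ W]
    [FiniteDimensional ℂ W] (c : S.Chart x W) :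
    IsRegularLocalRing (S.localRing x) ∧ ringKrullDim (S.localRing x) = Module.finrank ℂ W := by
  let c' := c.trans (Module.finBasis ℂ W).equivFun
  let x' : c'.source := ⟨x, c'.mem_source⟩
  have h1 := isMorphism_iff.1 c'.isIsomorphism.1 x'
  have h2 := isMorphism_iff.1 c'.isIsomorphism.2 (c'.equiv x')
  let e₁ : (affine _).localRing (c'.equiv x') ≃+* (S.restrict c'.source).localRing x' :=
    localRingEquiv (g := c'.equiv.symm) rfl (by simp) h1 h2 (by simp) (by simp)
  classical
  have hmem := S.eventually_of_isOpen c'.isOpen_source c'.mem_source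
  -- A total retraction onto the chart domain. The value off the domain is irrelevant because only
  -- germs at `x` matter.
  let g : X → c'.source := fun y => if h : y ∈ c'.source then ⟨y, h⟩ else x'
  have hg : ∀ y : c'.source, g y = y := fun y => dif_pos y.2
  have hgx : g x = x' := hg x'
  have hgm : S.MorphismAt (S.restrict c'.source) g x := by
    refine MorphismAt.codomain_comap ((MorphismAt.id S x).congr ?_)
    filter_upwards [hmem] with y hy
    exact (congrArg Subtype.val (hg ⟨y, hy⟩)).symm
  let e₂ : (S.restrict c'.source).localRing x' ≃+* S.localRing x :=
    localRingEquiv (f := g) (g := Subtype.val) hgx rfl hgm (morphismAt_comap S _ x')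
      (by filter_upwards [hmem] with y hy using congrArg Subtype.val (hg ⟨y, hy⟩))
      (Eventually.of_forall hg)
  obtain ⟨h3, h4⟩ := affine_localRing_regular (c'.equiv x')
  refine ⟨IsRegularLocalRing.of_ringEquiv (e₁.trans e₂), ?_⟩
  rw [← ringKrullDim_eq_of_ringEquiv (e₁.trans e₂), h4]
  simp

/-! ### Quasi-compactness -/

/-- Finite dimensional vector spaces are Noetherian in the Zariski topology. -/
theorem noetherianSpace_affine (W : Type*) [AddCommGroup W] [Module ℂ W] [FiniteDimensional ℂ W] :
    @TopologicalSpace.NoetherianSpace W (affine W).top := by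
  let _ := (affine W).top
  classical
  have hfg : (polynomialFunctions W).FG := by
    let b := Module.finBasis ℂ W
    refine ⟨Finset.univ.image fun i => (b.coord i : W → ℂ), le_antisymm ?_ ?_⟩
    · refine Algebra.adjoin_mono fun f hf => ?_
      simp only [Finset.coe_image, Finset.coe_univ, Set.image_univ, Set.mem_range] at hf
      obtain ⟨i, rfl⟩ := hf
      exact ⟨b.coord i, rfl⟩
    · refine Algebra.adjoin_le ?_
      rintro _ ⟨φ, rfl⟩
      have : (φ : W → ℂ) = ∑ i, φ (b i) • (b.coord i : W → ℂ) := by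
        funext w
        conv_lhs => rw [← b.sum_repr w]
        simp only [map_sum, map_smul, smul_eq_mul, Finset.sum_apply, Pi.smul_apply,
          Module.Basis.coord_apply, mul_comm]
      rw [this]
      exact sum_mem fun i _ => Subalgebra.smul_mem _ (Algebra.subset_adjoin (by simp)) _
  have : Algebra.FiniteType ℂ (polynomialFunctions W) :=
    (Subalgebra.fg_iff_finiteType _).1 hfg
  have : IsNoetherianRing (polynomialFunctions W) := Algebra.FiniteType.isNoetherianRing ℂ _
  let ev : W → polynomialFunctions W →+* ℂ := fun w =>
    (Pi.evalRingHom (fun _ : W => ℂ) w).comp (polynomialFunctions W).val.toRingHom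
  let i : W → PrimeSpectrum (polynomialFunctions W) := fun w =>
    ⟨RingHom.ker (ev w), RingHom.ker_isPrime _⟩
  -- Sending a point to the kernel of evaluation pulls basic open sets of the spectrum back to
  -- nonvanishing loci. The Zariski topology is thus induced from the spectrum of a Noetherian ring.
  have hi : Topology.IsInducing i := by
    refine ⟨TopologicalSpace.ext_nhds fun w => ?_⟩
    rw [nhds_induced]
    ext N
    rw [PrimeSpectrum.isTopologicalBasis_basic_opens.nhds_hasBasis.comap i |>.mem_iff]
    constructor
    · intro hN
      obtain ⟨-, b, hb, -, hb0, h⟩ := eventually_generate_iff.1 hN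
      exact ⟨_, ⟨⟨⟨b, hb⟩, rfl⟩, hb0⟩, fun z hz => h z trivial hz⟩
    · rintro ⟨_, ⟨⟨b, rfl⟩, hb0⟩, h⟩
      exact eventually_generate_iff.2 ⟨(), b.1, b.2, trivial, hb0, fun z _ hz => h hz⟩
  exact hi.noetherianSpace

/-- The image of a subset of a finite dimensional vector space under a morphism is quasi-compact. -/
theorem compactSpace_of_surjective {W : Type*} [AddCommGroup W] [Module ℂ W]
    [FiniteDimensional ℂ W] {A : Set W} {S : FnStr X} {f : A → X}
    (hf : ((affine W).restrict A).IsMorphism S f) (hs : Function.Surjective f) :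
    @CompactSpace X S.top := by
  let _ := (affine W).top
  let _ := S.top
  have := noetherianSpace_affine W
  have hA : TopologicalSpace.NoetherianSpace A :=
    (Topology.IsInducing.subtypeVal (t := A)).noetherianSpace
  have hc : Continuous f := continuous_def.2 hf.1
  exact isCompact_univ_iff.1 (hs.range_eq ▸ isCompact_range hc)

/-- A quasi-compact separated space with functions that is locally an affine space is a variety. -/
theorem isVariety_of_charts {S : FnStr X} (hS : @CompactSpace X S.top)
    (h : ∀ x, ∃ (d : ℕ), Nonempty (S.Chart x (Fin d → ℂ)))
    (hd : IsClosed[(S.prod S).top] (Set.diagonal X)) : S.IsVariety := by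
  refine ⟨?_, hd⟩
  let _ := S.top
  choose d c using h
  have c := fun x => (c x).some
  obtain ⟨t, ht⟩ := isCompact_univ.elim_finite_subcover (fun x => (c x).source)
    (fun x => (c x).isOpen_source) fun x _ => Set.mem_iUnion.2 ⟨x, (c x).mem_source⟩
  refine ⟨t.card, fun i => (c (t.equivFin.symm i)).source, fun i => (c _).isOpen_source,
    Set.eq_univ_of_forall fun x => ?_, fun i => (c _).isAffineVariety⟩
  obtain ⟨y, hy, hx⟩ := Set.mem_iUnion₂.1 (ht (Set.mem_univ x))
  exact Set.mem_iUnion.2 ⟨t.equivFin ⟨y, hy⟩, by rwa [Equiv.symm_apply_apply]⟩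

end FnStr

/-! ### Affine charts of Grassmannians -/

namespace Gr

open FnStr

variable {V : Type*} [AddCommGroup V] [Module ℂ V] {r : ℕ}

/-- The subspace `U` is mapped isomorphically to `ℂ ^ r` by `p`. -/
def Transverse (p : V →ₗ[ℂ] (Fin r → ℂ)) (U : Gr V r) : Prop :=
  Function.Bijective (p.domRestrict U.1)

theorem transverse_iff [FiniteDimensional ℂ V] {p : V →ₗ[ℂ] (Fin r → ℂ)} {U : Gr V r} :
    Transverse p U ↔ ∀ x ∈ U.1, p x = 0 → x = 0 := by
  have h : Module.finrank ℂ U.1 = Module.finrank ℂ (Fin r → ℂ) := by simp [U.2]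
  rw [Transverse, Function.Bijective, ← LinearMap.injective_iff_surjective_of_finrank_eq_finrank h,
    and_self, injective_iff_map_eq_zero]
  simp [Subtype.forall]

open Classical in
/-- The basis of `U` that is mapped to the standard basis by `p`. -/
noncomputable def frame (p : V →ₗ[ℂ] (Fin r → ℂ)) (U : Gr V r) (i : Fin r) : V :=
  -- The value `0` off the transverse locus makes this a function on the whole Grassmannian, so that
  -- its regularity at transverse points can be stated without restricting.
  if h : Transverse p U then ((LinearEquiv.ofBijective _ h).symm (Pi.single i 1) : U.1) else 0

variable {p : V →ₗ[ℂ] (Fin r → ℂ)} {U : Gr V r}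

theorem frame_mem (p : V →ₗ[ℂ] (Fin r → ℂ)) (U : Gr V r) (i : Fin r) : frame p U i ∈ U.1 := by
  rw [frame]
  split_ifs with h
  · exact Subtype.property _
  · exact zero_mem _

theorem Transverse.apply_frame (h : Transverse p U) (i : Fin r) :
    p (frame p U i) = Pi.single i 1 := by
  rw [frame, dif_pos h]
  exact (LinearEquiv.ofBijective _ h).apply_symm_apply _

theorem Transverse.eq_of_apply_eq (h : Transverse p U) {x y : V} (hx : x ∈ U.1) (hy : y ∈ U.1)
    (hxy : p x = p y) : x = y :=
  congrArg Subtype.val (h.1 (a₁ := ⟨x, hx⟩) (a₂ := ⟨y, hy⟩) hxy)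

theorem Transverse.sum_frame (h : Transverse p U) {x : V} (hx : x ∈ U.1) :
    ∑ i, p x i • frame p U i = x := by
  refine h.eq_of_apply_eq (sum_mem fun i _ => U.1.smul_mem _ (frame_mem p U i)) hx ?_
  simp only [map_sum, map_smul, h.apply_frame]
  conv_rhs => rw [← Finset.univ_sum_single (p x)]
  simp [← Pi.single_smul]

theorem Transverse.eq_frame (h : Transverse p U) {x : V} {i : Fin r} (hx : x ∈ U.1)
    (hp : p x = Pi.single i 1) : x = frame p U i :=
  h.eq_of_apply_eq hx (frame_mem p U i) (hp.trans (h.apply_frame i).symm)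

theorem Transverse.span_frame (h : Transverse p U) :
    Submodule.span ℂ (Set.range (frame p U)) = U.1 := by
  refine le_antisymm (Submodule.span_le.2 ?_) fun x hx => ?_
  · rintro _ ⟨i, rfl⟩
    exact frame_mem p U i
  · rw [← h.sum_frame hx]
    exact sum_mem fun i _ => Submodule.smul_mem _ _ (Submodule.subset_span ⟨i, rfl⟩)

theorem linearIndependent_of_apply_eq_single {v : Fin r → V} (h : ∀ i, p (v i) = Pi.single i 1) :
    LinearIndependent ℂ v := by
  refine LinearIndependent.of_comp p ?_
  have : (p ∘ v) = fun i => Pi.single i 1 := funext h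
  rw [this]
  exact Pi.linearIndependent_single_one _ _

/-- The map `p` is onto already on the span, hence bijective there by dimension; uniqueness then
identifies `v` with the normalized frame. -/
theorem transverse_span_of_apply_eq_single {v : Stiefel V r} (h : ∀ i, p (v.1 i) = Pi.single i 1) :
    Transverse p (Stiefel.span V r v) ∧ frame p (Stiefel.span V r v) = v.1 := by
  have hv : ∀ i, v.1 i ∈ (Stiefel.span V r v).1 := fun i => Submodule.subset_span ⟨i, rfl⟩
  have ht : Transverse p (Stiefel.span V r v) := by
    have hsurj : Function.Surjective (p.domRestrict (Stiefel.span V r v).1) := fun c => by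
      refine ⟨⟨∑ i, c i • v.1 i, sum_mem fun i _ => Submodule.smul_mem _ _ (hv i)⟩, ?_⟩
      simp only [LinearMap.domRestrict_apply, map_sum, map_smul, h]
      conv_rhs => rw [← Finset.univ_sum_single c]
      simp [← Pi.single_smul]
    have : FiniteDimensional ℂ (Stiefel.span V r v).1 :=
      FiniteDimensional.span_of_finite ℂ (Set.finite_range _)
    refine ⟨(LinearMap.injective_iff_surjective_of_finrank_eq_finrank ?_).2 hsurj, hsurj⟩
    simp [(Stiefel.span V r v).2]
  exact ⟨ht, funext fun i => (ht.eq_frame (hv i) (h i)).symm⟩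

theorem linearIndependent_frame (h : Transverse p U) : LinearIndependent ℂ (frame p U) :=
  linearIndependent_of_apply_eq_single h.apply_frame

/-- The frame of `U` as a basis. -/
noncomputable def Transverse.basis (h : Transverse p U) : Module.Basis (Fin r) ℂ U.1 :=
  Module.Basis.ofEquivFun (LinearEquiv.ofBijective _ h)

theorem Transverse.coe_basis (h : Transverse p U) (i : Fin r) : (h.basis i : V) = frame p U i := by
  rw [frame, dif_pos h, Transverse.basis, Module.Basis.coe_ofEquivFun]

/-- The matrix of the images under `p` of the members of a frame. -/
def frameMatrix (p : V →ₗ[ℂ] (Fin r → ℂ)) (v : Fin r → V) : Matrix (Fin r) (Fin r) ℂ :=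
  Matrix.of fun i j => p (v j) i

theorem frameMatrix_mulVec (p : V →ₗ[ℂ] (Fin r → ℂ)) (v : Fin r → V) (c : Fin r → ℂ) :
    (frameMatrix p v).mulVec c = p (∑ j, c j • v j) := by
  funext i
  simp [Matrix.mulVec, dotProduct, frameMatrix, mul_comm]

variable [FiniteDimensional ℂ V]

theorem exists_transverse (U : Gr V r) : ∃ p : V →ₗ[ℂ] (Fin r → ℂ), Transverse p U := by
  let e : U.1 ≃ₗ[ℂ] (Fin r → ℂ) := LinearEquiv.ofFinrankEq _ _ (by simp [U.2])
  obtain ⟨p, hp⟩ := e.toLinearMap.exists_extend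
  refine ⟨p, ?_⟩
  have : p.domRestrict U.1 = e.toLinearMap := hp
  rw [Transverse, this]
  exact e.bijective

/-- Linear combinations of the frame identify the kernel of the matrix with the kernel of `p` on the
span. On the Stiefel variety transversality is therefore the nonvanishing of a determinant, an open
condition. -/
theorem transverse_span_iff (p : V →ₗ[ℂ] (Fin r → ℂ)) (v : Stiefel V r) :
    Transverse p (Stiefel.span V r v) ↔ (frameMatrix p v.1).det ≠ 0 := by
  rw [← not_iff_not, not_not, ← Matrix.exists_mulVec_eq_zero_iff, transverse_iff]
  simp only [frameMatrix_mulVec]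
  push Not
  constructor
  · rintro ⟨x, hx, hpx, h0⟩
    obtain ⟨c, rfl⟩ := (Submodule.mem_span_range_iff_exists_fun ℂ).1 hx
    refine ⟨c, ?_, hpx⟩
    rintro rfl
    simp at h0
  · rintro ⟨c, hc, h⟩
    refine ⟨_, (Submodule.mem_span_range_iff_exists_fun ℂ).2 ⟨c, rfl⟩, h, fun h0 => hc ?_⟩
    exact funext (Fintype.linearIndependent_iff.1 v.2 c h0)

/-- Normalizing a frame is the change of basis by the inverse of its matrix, whose entries are
regular wherever the determinant is nonzero. -/
theorem frame_span {v : Stiefel V r} (h : Transverse p (Stiefel.span V r v)) (i : Fin r) :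
    frame p (Stiefel.span V r v) i = ∑ j, (frameMatrix p v.1)⁻¹ j i • v.1 j := by
  refine (h.eq_frame ?_ ?_).symm
  · exact sum_mem fun j _ => Submodule.smul_mem _ _ (Submodule.subset_span ⟨j, rfl⟩)
  · rw [← frameMatrix_mulVec p v.1 fun j => (frameMatrix p v.1)⁻¹ j i]
    funext k
    have := Matrix.mul_nonsing_inv (frameMatrix p v.1)
      (isUnit_iff_ne_zero.2 ((transverse_span_iff p v).1 h))
    have := congrFun (congrFun this k) i
    rw [Matrix.mul_apply] at this
    rw [Matrix.mulVec, dotProduct, this, Matrix.one_apply, Pi.single_apply]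

omit [FiniteDimensional ℂ V] in
theorem morphismAt_coe_stiefel (v : Stiefel V r) (j : Fin r) :
    ((affine (Fin r → V)).restrict (Stiefel V r)).MorphismAt (affine V) (fun v => v.1 j) v :=
  (morphismAt_comap (affine (Fin r → V)) _ v).linear_comp (LinearMap.proj (φ := fun _ => V) j)

omit [FiniteDimensional ℂ V] in
theorem regularAt_frameMatrix (p : V →ₗ[ℂ] (Fin r → ℂ)) (v : Stiefel V r) (i j : Fin r) :
    ((affine (Fin r → V)).restrict (Stiefel V r)).RegularAt
      (fun v => frameMatrix p v.1 i j) v :=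
  (morphismAt_coe_stiefel v j).regularAt_linear (LinearMap.proj i ∘ₗ p)

theorem isOpen_transverse (p : V →ₗ[ℂ] (Fin r → ℂ)) :
    IsOpen[(Gr.str V r).top] {U | Transverse p U} := fun _ => by
  refine isOpen_of_eventually _ fun v hv => ?_
  rw [Set.mem_preimage, Set.mem_ofPred_eq, transverse_span_iff] at hv
  filter_upwards [FnStr.ne_zero' _ (RegularAt.det fun i j => regularAt_frameMatrix p v i j) hv]
    with z hz
  exact (transverse_span_iff p z).2 hz

/-- The normalized frame depends regularly on the subspace. -/
theorem morphismAt_frame (h : Transverse p U) (i : Fin r) :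
    (Gr.str V r).MorphismAt (affine V) (fun U => frame p U i) U := by
  refine .codomain_affine fun φ => ⟨{U | Transverse p U}, isOpen_transverse p, h, fun _ v hv => ?_⟩
  have hdet := (transverse_span_iff p v).1 hv
  refine FnStr.congr' _ (f := fun z => ∑ j, (frameMatrix p z.1)⁻¹ j i * φ (z.1 j)) ?_ ?_
  · filter_upwards [eventually_of_isOpen _ (isOpen_transverse p ()) hv] with z hz
    rw [frame_span hz]
    simp
  · refine RegularAt.sum _ fun j _ => ?_
    exact (RegularAt.matrix_inv (fun i j => regularAt_frameMatrix p v i j) hdet j i).mul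
      ((morphismAt_coe_stiefel v j).regularAt_linear φ)

omit [FiniteDimensional ℂ V] in
theorem morphismAt_span {X : Type*} {S : FnStr X} {f : X → Stiefel V r} {x : X}
    (h : ∀ i, S.MorphismAt (affine V) (fun y => (f y).1 i) x) :
    S.MorphismAt (Gr.str V r) (fun y => Stiefel.span V r (f y)) x :=
  (morphismAt_final (S := fun _ : Unit => (affine (Fin r → V)).restrict (Stiefel V r))
    (p := fun _ => Stiefel.span V r) () (f x)).comp
      (MorphismAt.codomain_comap (MorphismAt.codomain_pi h))

end Gr

/-! ### Isotropic frames -/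

/-- A frame of an isotropic subspace together with a dual frame of another isotropic subspace, for
a form with `(x, y) = ε (y, x)`. -/
structure DualFrames {V : Type*} [AddCommGroup V] [Module ℂ V] (B : LinearMap.BilinForm ℂ V)
    (ε : ℂ) (r : ℕ) where
  u : Fin r → V
  w : Fin r → V
  mul_self : ε * ε = 1
  swap : ∀ x y, B x y = ε * B y x
  uu : ∀ i j, B (u i) (u j) = 0
  ww : ∀ i j, B (w i) (w j) = 0
  uw : ∀ i j, B (u i) (w j) = if i = j then 1 else 0

namespace DualFrames

variable {V : Type*} [AddCommGroup V] [Module ℂ V] {B : LinearMap.BilinForm ℂ V} {ε : ℂ} {r : ℕ}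

theorem exists_of_isotropic [FiniteDimensional ℂ V] (hB : B.Nondegenerate) (hε : ε * ε = 1)
    (hswap : ∀ x y, B x y = ε * B y x) {u : Fin r → V} (hu : LinearIndependent ℂ u)
    (huu : ∀ i j, B (u i) (u j) = 0) : ∃ d : DualFrames B ε r, d.u = u := by
  have h0 : ∀ j, ∃ w, ∀ i, B (u i) w = if i = j then 1 else 0 := by
    intro j
    obtain ⟨φ, hφ⟩ := (((Module.Basis.span hu).coord j).exists_extend)
    -- Here `φ` extends the `j`-th coordinate on the span of `u`. The factor `ε` compensates for the
    -- exchange of the two arguments of the form.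
    refine ⟨(B.toDual hB).symm (ε • φ), fun i => ?_⟩
    rw [hswap, ← LinearMap.BilinForm.toDual_def hB, LinearEquiv.apply_symm_apply,
      LinearMap.smul_apply, smul_eq_mul, ← mul_assoc, hε, one_mul]
    have := LinearMap.congr_fun hφ (Module.Basis.span hu i)
    simpa [Module.Basis.span_apply, Finsupp.single_apply] using! this
  choose w hw using h0
  have hwu : ∀ i j, B (w j) (u i) = if i = j then ε else 0 := fun i j => by
    rw [hswap, hw]; simp
  -- Adding elements of `⟨u⟩` keeps the pairings with `u`, since `u` is isotropic. Each of the two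
  -- cross terms removes half of `B (w i) (w j)`, so the corrected dual frame is isotropic.
  refine ⟨⟨u, fun i => w i - (1 / 2 : ℂ) • ∑ k, B (w i) (w k) • u k, hε, hswap, huu,
    fun i j => ?_, fun i j => ?_⟩, rfl⟩
  · simp [hw, hwu, huu]
    rw [hswap (w j) (w i)]
    linear_combination (-1/2) * B (w i) (w j) * hε
  · simp [huu, hw]

variable (d : DualFrames B ε r)

theorem wu (i j : Fin r) : B (d.w i) (d.u j) = if i = j then ε else 0 := by
  rw [d.swap, d.uw]
  simp [eq_comm]

/-- The coordinates with respect to the first frame. -/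
def p : V →ₗ[ℂ] (Fin r → ℂ) := LinearMap.pi fun i => ε • B (d.w i)

/-- The coordinates with respect to the second frame. -/
def q : V →ₗ[ℂ] (Fin r → ℂ) := LinearMap.pi fun i => B (d.u i)

theorem p_apply (x : V) (i : Fin r) : d.p x i = ε * B (d.w i) x := rfl

theorem q_apply (x : V) (i : Fin r) : d.q x i = B (d.u i) x := rfl

theorem p_u (i : Fin r) : d.p (d.u i) = Pi.single i 1 := by
  funext j
  simp [p_apply, wu, Pi.single_apply, d.mul_self]

theorem p_w (i : Fin r) : d.p (d.w i) = 0 := by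
  funext j
  simp [p_apply, d.ww]

theorem q_u (i : Fin r) : d.q (d.u i) = 0 := by
  funext j
  simp [q_apply, d.uu]

theorem q_w (i : Fin r) : d.q (d.w i) = Pi.single i 1 := by
  funext j
  simp [q_apply, d.uw, Pi.single_apply]

/-- The orthogonal complement of the two frames. -/
def E : Submodule ℂ V := LinearMap.ker (d.p.prod d.q)

theorem mem_E {x : V} : x ∈ d.E ↔ d.p x = 0 ∧ d.q x = 0 := by
  simp [E]

theorem bilin_u_E (i : Fin r) {x : V} (hx : x ∈ d.E) : B (d.u i) x = 0 :=
  congrFun (d.mem_E.1 hx).2 i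

theorem bilin_w_E (i : Fin r) {x : V} (hx : x ∈ d.E) : B (d.w i) x = 0 := by
  have := congrFun (d.mem_E.1 hx).1 i
  rw [p_apply, Pi.zero_apply] at this
  exact (mul_eq_zero.1 this).resolve_left (left_ne_zero_of_mul_eq_one d.mul_self)

theorem bilin_E_u (i : Fin r) {x : V} (hx : x ∈ d.E) : B x (d.u i) = 0 := by
  rw [d.swap, d.bilin_u_E i hx, mul_zero]

/-- The two frames show that the pair of coordinate maps is onto `ℂ ^ r × ℂ ^ r`; `E` is its kernel.
-/
theorem finrank_E [FiniteDimensional ℂ V] : Module.finrank ℂ d.E + 2 * r = Module.finrank ℂ V := by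
  have hs : LinearMap.range (d.p.prod d.q) = ⊤ := by
    rw [LinearMap.range_eq_top]
    rintro ⟨a, b⟩
    refine ⟨∑ i, a i • d.u i + ∑ i, b i • d.w i, ?_⟩
    refine Prod.ext ?_ ?_
    · change d.p _ = a
      simp only [map_add, map_sum, map_smul, p_u, p_w, smul_zero, Finset.sum_const_zero, add_zero]
      conv_rhs => rw [← Finset.univ_sum_single a]
      simp [← Pi.single_smul]
    · change d.q _ = b
      simp only [map_add, map_sum, map_smul, q_u, q_w, smul_zero, Finset.sum_const_zero, zero_add]
      conv_rhs => rw [← Finset.univ_sum_single b]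
      simp [← Pi.single_smul]
  have := LinearMap.finrank_range_add_finrank_ker (d.p.prod d.q)
  rw [hs, finrank_top, Module.finrank_prod, Module.finrank_fin_fun] at this
  change _ + Module.finrank ℂ d.E = _ at this
  lia

/-- The projection to the orthogonal complement. -/
def projE : V →ₗ[ℂ] d.E :=
  LinearMap.codRestrict d.E (LinearMap.id - Fintype.linearCombination ℂ d.u ∘ₗ d.p
    - Fintype.linearCombination ℂ d.w ∘ₗ d.q) fun x => by
    rw [mem_E]
    simp only [LinearMap.sub_apply, LinearMap.id_apply, LinearMap.comp_apply,
      Fintype.linearCombination_apply, map_sub, map_sum, map_smul, p_u, p_w, q_u, q_w,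
      smul_zero, Finset.sum_const_zero, sub_zero]
    constructor
    · conv_lhs => enter [1]; rw [← Finset.univ_sum_single (d.p x)]
      simp [← Pi.single_smul]
    · conv_lhs => enter [1]; rw [← Finset.univ_sum_single (d.q x)]
      simp [← Pi.single_smul]

theorem decomposition (x : V) :
    x = ∑ i, d.p x i • d.u i + ∑ i, d.q x i • d.w i + d.projE x := by
  simp [projE, Fintype.linearCombination_apply]

theorem projE_u (i : Fin r) : d.projE (d.u i) = 0 := by
  refine Subtype.ext ?_
  simp [projE, p_u, q_u]

theorem projE_w (i : Fin r) : d.projE (d.w i) = 0 := by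
  refine Subtype.ext ?_
  simp [projE, p_w, q_w]

theorem projE_E (x : d.E) : d.projE x = x := by
  refine Subtype.ext ?_
  simp [projE, d.mem_E.1 x.2]

/-- The form is hyperbolic on the span of the two frames, and `E` is orthogonal to both. -/
theorem bilin_apply (x y : V) : B x y =
    ∑ i, d.p x i * d.q y i + ε * ∑ i, d.q x i * d.p y i + B (d.projE x) (d.projE y) := by
  have hu : ∀ i, B x (d.u i) = ε * d.q x i := fun i => by rw [d.swap, q_apply]
  have hw : ∀ i, B x (d.w i) = d.p x i := fun i => by rw [d.swap, p_apply]
  have hE : B x (d.projE y) = B (d.projE x) (d.projE y) := by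
    conv_lhs => rw [d.decomposition x]
    simp [d.bilin_u_E _ (d.projE y).2, d.bilin_w_E _ (d.projE y).2]
  conv_lhs => rw [d.decomposition y]
  simp only [map_add, map_sum, map_smul, hu, hw, hE, smul_eq_mul, Finset.mul_sum]
  rw [add_comm (∑ i, d.p y i * _)]
  congr 2
  · exact Finset.sum_congr rfl fun i _ => by ring
  · exact Finset.sum_congr rfl fun i _ => by ring

end DualFrames

/-! ### Existence of isotropic frames -/

/-- For independent `x` and `y` with `B y y ≠ 0`, the value of the form on `x + t y` is a quadratic
polynomial in `t`, which has a complex root. -/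
theorem exists_isotropic_ne_zero {V : Type*} [AddCommGroup V] [Module ℂ V]
    (B : LinearMap.BilinForm ℂ V) (h : 1 < Module.finrank ℂ V) : ∃ e, e ≠ 0 ∧ B e e = 0 := by
  have := Module.nontrivial_of_finrank_pos (R := ℂ) (M := V) (by lia)
  obtain ⟨x, hx⟩ := exists_ne (0 : V)
  obtain ⟨y, hxy⟩ := exists_linearIndependent_pair_of_one_lt_finrank h hx
  by_cases hyy : B y y = 0
  · exact ⟨y, hxy.ne_zero 1, hyy⟩
  obtain ⟨s, hs⟩ := IsAlgClosed.exists_eq_mul_self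
    (discrim (B y y) (B x y + B y x) (B x x))
  obtain ⟨t, ht⟩ := exists_quadratic_eq_zero hyy ⟨s, hs⟩
  refine ⟨x + t • y, fun h0 => ?_, ?_⟩
  · have := LinearIndependent.pair_iff.1 hxy 1 t (by simpa using h0)
    exact one_ne_zero this.1
  · simp only [map_add, map_smul, LinearMap.add_apply, LinearMap.smul_apply, smul_eq_mul]
    linear_combination ht

/-- Induction on `r`: after completion to dual frames, the complement `E` still has dimension at
least two. It contains a nonzero isotropic vector orthogonal to the frame found so far. -/
theorem exists_isotropic_frame {V : Type*} [AddCommGroup V] [Module ℂ V] [FiniteDimensional ℂ V]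
    {B : LinearMap.BilinForm ℂ V} {ε : ℂ} (hB : B.Nondegenerate) (hε : ε * ε = 1)
    (hswap : ∀ x y, B x y = ε * B y x) {r : ℕ} (hr : 2 * r ≤ Module.finrank ℂ V) :
    ∃ u : Fin r → V, LinearIndependent ℂ u ∧ ∀ i j, B (u i) (u j) = 0 := by
  induction r with
  | zero => exact ⟨Fin.elim0, linearIndependent_empty_type, fun i => i.elim0⟩
  | succ r ih =>
    obtain ⟨u, hu, huu⟩ := ih (by lia)
    obtain ⟨d, rfl⟩ := DualFrames.exists_of_isotropic hB hε hswap hu huu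
    have hE := d.finrank_E
    obtain ⟨⟨e, heE⟩, he, hee⟩ := exists_isotropic_ne_zero (B.restrict d.E) (by lia)
    -- A vector of `E` in the span of the old frame has zero coordinates `d.p`, so it vanishes.
    refine ⟨Fin.cons e d.u, hu.finCons fun h => he (Subtype.ext ?_), fun i j => ?_⟩
    · obtain ⟨c, rfl⟩ := (Submodule.mem_span_range_iff_exists_fun ℂ).1 h
      have h1 := (d.mem_E.1 heE).1
      have h2 : c = 0 := by
        simp only [map_sum, map_smul, d.p_u] at h1
        conv_lhs => rw [← Finset.univ_sum_single c]
        simpa [← Pi.single_smul] using h1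
      simp [h2]
    · refine Fin.cases ?_ (fun i => ?_) i <;> refine Fin.cases ?_ (fun j => ?_) j
      · exact hee
      · exact d.bilin_E_u j heE
      · exact d.bilin_u_E i heE
      · exact huu i j

/-! ### Symmetric and skew-symmetric matrices -/

/-- The matrices with `aᵀ = -ε a`. -/
def signedMatrices (r : ℕ) (ε : ℂ) : Submodule ℂ (Fin r → Fin r → ℂ) where
  carrier := {a | ∀ i j, a j i = -ε * a i j}
  add_mem' h h' i j := by simp only [Pi.add_apply, h i j, h' i j]; ring
  zero_mem' i j := by simp
  smul_mem' c a h i j := by simp only [Pi.smul_apply, smul_eq_mul, h i j]; ring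

theorem card_lt_le (r : ℕ) :
    2 * Fintype.card {p : Fin r × Fin r // p.1 < p.2} + r = r * r ∧
      2 * Fintype.card {p : Fin r × Fin r // p.1 ≤ p.2} = r * r + r := by
  have h1 : Fintype.card {p : Fin r × Fin r // p.1 < p.2} +
      Fintype.card {p : Fin r × Fin r // ¬ p.1 < p.2} = r * r := by
    rw [Fintype.card_subtype_compl, Nat.add_sub_cancel' (Fintype.card_subtype_le _)]
    simp
  have h2 : Fintype.card {p : Fin r × Fin r // ¬ p.1 < p.2} =
      Fintype.card {p : Fin r × Fin r // p.1 ≤ p.2} :=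
    Fintype.card_congr ((Equiv.prodComm _ _).subtypeEquiv (by simp))
  have h3 : Fintype.card {p : Fin r × Fin r // p.1 ≤ p.2} =
      Fintype.card {p : Fin r × Fin r // p.1 < p.2} + r := by
    have h4 : Fintype.card {p : Fin r × Fin r // p.1 = p.2} = r := by
      conv_rhs => rw [← Fintype.card_fin r]
      exact Fintype.card_congr ⟨fun p => p.1.1, fun i => ⟨(i, i), rfl⟩,
        fun ⟨⟨i, j⟩, (h : i = j)⟩ => by subst h; rfl, fun i => rfl⟩
    have h5 := Fintype.card_subtype_or_disjoint (fun p : Fin r × Fin r => p.1 < p.2)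
      (fun p : Fin r × Fin r => p.1 = p.2) (by
        rw [Pi.disjoint_iff]
        intro p
        simp only [Prop.disjoint_iff]
        exact fun h => h.1.ne h.2)
    refine (Fintype.card_congr (Equiv.subtypeEquivRight fun p => le_iff_lt_or_eq)).trans
      (h5.trans ?_)
    convert! congrArg _ h4 using 2
  lia

/-- For a symmetric form the matrices are skew-symmetric: the diagonal vanishes and the entries
strictly above it are free. -/
theorem finrank_signedMatrices_one (r : ℕ) :
    2 * Module.finrank ℂ (signedMatrices r 1) + r = r * r := by
  let l : signedMatrices r 1 ≃ₗ[ℂ] ({p : Fin r × Fin r // p.1 < p.2} → ℂ) :=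
    { toFun := fun a p => a.1 p.1.1 p.1.2
      map_add' := fun _ _ => rfl
      map_smul' := fun _ _ => rfl
      invFun := fun s => ⟨fun i j => if h : i < j then s ⟨(i, j), h⟩ else
        if h : j < i then -s ⟨(j, i), h⟩ else 0, fun i j => by
          rcases lt_trichotomy i j with h | rfl | h
          · simp [h, h.not_gt]
          · simp
          · simp [h, h.not_gt]⟩
      left_inv := fun a => by
        refine Subtype.ext (funext fun i => funext fun j => ?_)
        rcases lt_trichotomy i j with h | rfl | h
        · simp [h]
        · have := a.2 i i
          simp only [lt_irrefl, dite_false]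
          linear_combination (-1/2) * this
        · have := a.2 j i
          simp [h, h.not_gt, this]
      right_inv := fun s => by
        funext p
        exact dif_pos p.2 }
  rw [l.finrank_eq, Module.finrank_fintype_fun_eq_card]
  exact (card_lt_le r).1

/-- For an alternating form the matrices are symmetric, so the diagonal entries are free as well. -/
theorem finrank_signedMatrices_neg_one (r : ℕ) :
    2 * Module.finrank ℂ (signedMatrices r (-1)) = r * r + r := by
  let l : signedMatrices r (-1) ≃ₗ[ℂ] ({p : Fin r × Fin r // p.1 ≤ p.2} → ℂ) :=
    { toFun := fun a p => a.1 p.1.1 p.1.2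
      map_add' := fun _ _ => rfl
      map_smul' := fun _ _ => rfl
      invFun := fun s => ⟨fun i j => if h : i ≤ j then s ⟨(i, j), h⟩ else
        s ⟨(j, i), (not_le.1 h).le⟩, fun i j => by
          rcases lt_trichotomy i j with h | rfl | h
          · simp [h.le, h.not_ge]
          · simp
          · simp [h.le, h.not_ge]⟩
      left_inv := fun a => by
        refine Subtype.ext (funext fun i => funext fun j => ?_)
        have := a.2 j i
        by_cases h : i ≤ j
        · simp [h]
        · simp [h, this]
      right_inv := fun s => by
        funext p
        exact dif_pos p.2 }
  rw [l.finrank_eq, Module.finrank_fintype_fun_eq_card]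
  exact (card_lt_le r).2

section NullCone

open FnStr

variable {V : Type*} [AddCommGroup V] [Module ℂ V] {B : LinearMap.BilinForm ℂ V} {m r : ℕ}

/-! ### Morphisms to and from the resolution of the null cone -/

theorem FnStr.MorphismAt.codomain_hom {X : Type*} {S : FnStr X}
    {f : X → (Fin m → ℂ) →ₗ[ℂ] V} {x : X}
    (h : ∀ l, S.MorphismAt (affine V) (fun y => f y (Pi.single l 1)) x) :
    S.MorphismAt (affine ((Fin m → ℂ) →ₗ[ℂ] V)) f x :=
  .of_injective ((Pi.basisFun ℂ (Fin m)).constr ℂ).symm.toLinearMap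
    (LinearEquiv.injective _) (.codomain_pi fun l => by simpa [Module.Basis.constr] using h l)

namespace NCQTilde

/-- The point of the resolution given by an isotropic subspace and a homomorphism to it. -/
def mk (U : IsotropicGr B r) (T : (Fin m → ℂ) →ₗ[ℂ] V) (h : ∀ x, T x ∈ U.1.1) :
    NCQTilde B m r :=
  ⟨(⟨T, Matrix.ext fun _ _ => U.2 _ (h _) _ (h _)⟩, U), by rintro _ ⟨x, rfl⟩; exact h x⟩

theorem apply_mem (P : NCQTilde B m r) (x : Fin m → ℂ) : P.1.1.1 x ∈ P.1.2.1.1 :=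
  P.2 ⟨x, rfl⟩

theorem ext {P Q : NCQTilde B m r} (h : P.1.1.1 = Q.1.1.1) (h' : P.1.2 = Q.1.2) : P = Q :=
  Subtype.ext (Prod.ext (Subtype.ext h) h')

theorem morphismAt_hom (P : NCQTilde B m r) :
    (NCQTilde.str B m r).MorphismAt (affine _) (fun P => P.1.1.1) P :=
  (morphismAt_comap _ _ _).comp ((morphismAt_fst _ _ _).comp (morphismAt_comap _ _ P))

theorem morphismAt_apply (P : NCQTilde B m r) (x : Fin m → ℂ) :
    (NCQTilde.str B m r).MorphismAt (affine V) (fun P => P.1.1.1 x) P :=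
  (morphismAt_hom P).linear_comp (LinearMap.applyₗ x)

theorem morphismAt_isotropicGr (P : NCQTilde B m r) :
    (NCQTilde.str B m r).MorphismAt (IsotropicGr.str B r) (fun P => P.1.2) P :=
  (morphismAt_snd _ _ _).comp (morphismAt_comap _ _ P)

theorem morphismAt_gr (P : NCQTilde B m r) :
    (NCQTilde.str B m r).MorphismAt (Gr.str V r) (fun P => P.1.2.1) P :=
  (morphismAt_comap _ _ _).comp (morphismAt_isotropicGr P)

theorem morphismAt_codomain {X : Type*} {S : FnStr X} {f : X → NCQTilde B m r} {x : X}
    (h : ∀ l, S.MorphismAt (affine V) (fun y => (f y).1.1.1 (Pi.single l 1)) x)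
    (h' : S.MorphismAt (Gr.str V r) (fun y => (f y).1.2.1) x) :
    S.MorphismAt (NCQTilde.str B m r) f x :=
  .codomain_comap (.prodMk (.codomain_comap (.codomain_hom h)) (.codomain_comap h'))

theorem morphismAt_frame [FiniteDimensional ℂ V] {p : V →ₗ[ℂ] (Fin r → ℂ)} {P : NCQTilde B m r}
    (h : Gr.Transverse p P.1.2.1) (i : Fin r) :
    (NCQTilde.str B m r).MorphismAt (affine V) (fun P => Gr.frame p P.1.2.1 i) P :=
  MorphismAt.comp (f := fun P : NCQTilde B m r => P.1.2.1) (Gr.morphismAt_frame h i)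
    (morphismAt_gr P)

theorem isOpen_transverse [FiniteDimensional ℂ V] (p : V →ₗ[ℂ] (Fin r → ℂ)) :
    IsOpen[(NCQTilde.str B m r).top] {P | Gr.Transverse p P.1.2.1} :=
  isOpen_of_eventually _ fun P hP =>
    (morphismAt_gr P).1.eventually (eventually_of_isOpen _ (Gr.isOpen_transverse p) hP)

end NCQTilde

/-! ### Charts of the resolution of the null cone -/

namespace DualFrames

variable {ε : ℂ} (d : DualFrames B ε r)

/-- The parameter space of the isotropic subspaces near the span of the first frame, and of the
homomorphisms to them. -/
abbrev ParamSpace (m : ℕ) : Type _ :=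
  signedMatrices r ε × (Fin r → d.E) × (Fin m → Fin r → ℂ)

/-- The isotropic frame with given parameters. -/
noncomputable def deform (z : d.ParamSpace m) (i : Fin r) : V :=
  -- With `c_ij` the coefficient of `w_j` and `x_i` the component in `E`, isotropy reads `c_ji + ε
  -- c_ij + B x_i x_j = 0`. The quadratic correction absorbs the last term and leaves the linear
  -- condition defining `signedMatrices`.
  d.u i + ∑ j, (z.1.1 i j - ε / 2 * B (z.2.1 i) (z.2.1 j)) • d.w j + z.2.1 i

theorem p_deform (z : d.ParamSpace m) (i : Fin r) : d.p (d.deform z i) = Pi.single i 1 := by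
  simp [deform, d.p_u, d.p_w, d.mem_E.1 (z.2.1 i).2]

theorem q_deform (z : d.ParamSpace m) (i j : Fin r) :
    d.q (d.deform z i) j = z.1.1 i j - ε / 2 * B (z.2.1 i) (z.2.1 j) := by
  have : (0 : Fin r → ℂ) = d.q (z.2.1 i) := (d.mem_E.1 (z.2.1 i).2).2.symm
  simp [deform, d.q_u, d.q_w, ← this, Pi.single_apply]

theorem projE_deform (z : d.ParamSpace m) (i : Fin r) : d.projE (d.deform z i) = z.2.1 i := by
  simp [deform, d.projE_u, d.projE_w, d.projE_E]

theorem bilin_of_p_eq_single {x y : V} {i j : Fin r} (hx : d.p x = Pi.single i 1)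
    (hy : d.p y = Pi.single j 1) :
    B x y = d.q y i + ε * d.q x j + B (d.projE x) (d.projE y) := by
  rw [d.bilin_apply, hx, hy]
  simp [Pi.single_apply]

theorem bilin_deform (z : d.ParamSpace m) (i j : Fin r) : B (d.deform z i) (d.deform z j) = 0 := by
  rw [d.bilin_of_p_eq_single (d.p_deform z i) (d.p_deform z j), q_deform, q_deform, projE_deform,
    projE_deform, z.1.2 i j, d.swap (z.2.1 j) (z.2.1 i)]
  linear_combination (-B (z.2.1 i) (z.2.1 j)) * d.mul_self

/-- The isotropic subspace with given parameters. -/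
noncomputable def deformSpan (z : d.ParamSpace m) : IsotropicGr B r :=
  ⟨Stiefel.span V r ⟨d.deform z, Gr.linearIndependent_of_apply_eq_single (d.p_deform z)⟩, by
    intro x hx y hy
    obtain ⟨a, rfl⟩ := (Submodule.mem_span_range_iff_exists_fun ℂ).1 hx
    obtain ⟨b, rfl⟩ := (Submodule.mem_span_range_iff_exists_fun ℂ).1 hy
    simp [d.bilin_deform]⟩

theorem deform_mem (z : d.ParamSpace m) (i : Fin r) : d.deform z i ∈ (d.deformSpan z).1.1 :=
  Submodule.subset_span (Set.mem_range_self i)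

theorem transverse_deformSpan (z : d.ParamSpace m) : Gr.Transverse d.p (d.deformSpan z).1 :=
  (Gr.transverse_span_of_apply_eq_single (d.p_deform z)).1

theorem frame_deformSpan (z : d.ParamSpace m) : Gr.frame d.p (d.deformSpan z).1 = d.deform z :=
  (Gr.transverse_span_of_apply_eq_single (v := ⟨d.deform z, _⟩) (d.p_deform z)).2

/-- The point of the resolution with given parameters. -/
noncomputable def toNCQTilde (z : d.ParamSpace m) : NCQTilde B m r :=
  NCQTilde.mk (d.deformSpan z) (Fintype.linearCombination ℂ fun l => ∑ i, z.2.2 l i • d.deform z i) fun x => by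
    rw [Fintype.linearCombination_apply]
    exact sum_mem fun _ _ => Submodule.smul_mem _ _ (sum_mem fun i _ => Submodule.smul_mem _ _
      (d.deform_mem z i))

theorem toNCQTilde_apply (z : d.ParamSpace m) (l : Fin m) :
    (d.toNCQTilde z).1.1.1 (Pi.single l 1) = ∑ i, z.2.2 l i • d.deform z i := by
  simp [toNCQTilde, NCQTilde.mk, Fintype.linearCombination_apply_single]

/-- The parameters of a point of the resolution. -/
noncomputable def params (P : NCQTilde B m r) (h : Gr.Transverse d.p P.1.2.1) : d.ParamSpace m :=
  (⟨fun i j => d.q (Gr.frame d.p P.1.2.1 i) j +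
      ε / 2 * B (d.projE (Gr.frame d.p P.1.2.1 i)) (d.projE (Gr.frame d.p P.1.2.1 j)), fun i j => by
    have h1 := P.1.2.2 _ (Gr.frame_mem d.p P.1.2.1 i) _ (Gr.frame_mem d.p P.1.2.1 j)
    rw [d.bilin_of_p_eq_single (h.apply_frame i) (h.apply_frame j)] at h1
    dsimp only
    rw [d.swap (d.projE (Gr.frame d.p P.1.2.1 j)) (d.projE (Gr.frame d.p P.1.2.1 i))]
    linear_combination h1 +
      B (d.projE (Gr.frame d.p P.1.2.1 i)) (d.projE (Gr.frame d.p P.1.2.1 j)) * d.mul_self⟩,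
    fun i => d.projE (Gr.frame d.p P.1.2.1 i), fun l => d.p (P.1.1.1 (Pi.single l 1)))

theorem deform_params (P : NCQTilde B m r) (h : Gr.Transverse d.p P.1.2.1) :
    d.deform (d.params P h) = Gr.frame d.p P.1.2.1 := by
  funext i
  conv_rhs => rw [d.decomposition (Gr.frame d.p P.1.2.1 i), h.apply_frame]
  simp [deform, params, Pi.single_apply]

theorem toNCQTilde_params (P : NCQTilde B m r) (h : Gr.Transverse d.p P.1.2.1) :
    d.toNCQTilde (d.params P h) = P := by
  refine NCQTilde.ext ?_ (Subtype.ext (Subtype.ext ?_))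
  · refine (Pi.basisFun ℂ (Fin m)).ext fun l => ?_
    rw [Pi.basisFun_apply, toNCQTilde_apply, deform_params]
    exact h.sum_frame (NCQTilde.apply_mem P _)
  · change Submodule.span ℂ (Set.range (d.deform (d.params P h))) = _
    rw [deform_params, h.span_frame]

theorem params_toNCQTilde (z : d.ParamSpace m) :
    d.params (d.toNCQTilde z) (d.transverse_deformSpan z) = z := by
  have hf : Gr.frame d.p (d.toNCQTilde z).1.2.1 = d.deform z := d.frame_deformSpan z
  refine Prod.ext (Subtype.ext ?_) (Prod.ext ?_ ?_)
  · funext i j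
    simp only [params, hf, d.q_deform, d.projE_deform]
    ring
  · funext i
    simp only [params, hf, d.projE_deform]
  · funext l
    simp only [params, toNCQTilde_apply, map_sum, map_smul, d.p_deform]
    conv_rhs => rw [← Finset.univ_sum_single (z.2.2 l)]
    simp [← Pi.single_smul]

variable [FiniteDimensional ℂ V]

theorem morphismAt_deform (z : d.ParamSpace m) (i : Fin r) :
    (affine (d.ParamSpace m)).MorphismAt (affine V) (fun z => d.deform z i) z := by
  have hE : ∀ i, (affine (d.ParamSpace m)).MorphismAt (affine V) (fun z => (z.2.1 i : V)) z :=
    fun i => morphismAt_linear (d.E.subtype ∘ₗ LinearMap.proj (φ := fun _ => d.E) i ∘ₗ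
      LinearMap.fst ℂ (Fin r → d.E) (Fin m → Fin r → ℂ) ∘ₗ
      LinearMap.snd ℂ (signedMatrices r ε) _) z
  have hk : ∀ i j, (affine (d.ParamSpace m)).RegularAt (fun z => z.1.1 i j) z := fun i j =>
    regularAt_linear (LinearMap.proj (φ := fun _ => ℂ) j ∘ₗ
      LinearMap.proj (φ := fun _ => Fin r → ℂ) i ∘ₗ (signedMatrices r ε).subtype ∘ₗ
      LinearMap.fst ℂ (signedMatrices r ε) ((Fin r → d.E) × (Fin m → Fin r → ℂ))) z
  exact ((MorphismAt.const _ _ _).add (MorphismAt.sum _ fun j _ => MorphismAt.smul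
    ((hk i j).sub ((FnStr.const' _ _ _).mul (MorphismAt.bilin B (hE i) (hE j))))
    (MorphismAt.const _ _ _))).add (hE i)

theorem morphismAt_toNCQTilde (z : d.ParamSpace m) :
    (affine (d.ParamSpace m)).MorphismAt (NCQTilde.str B m r) d.toNCQTilde z := by
  refine NCQTilde.morphismAt_codomain (fun l => ?_) ?_
  · simp only [toNCQTilde_apply]
    refine MorphismAt.sum _ fun i _ => MorphismAt.smul ?_ (d.morphismAt_deform z i)
    exact regularAt_linear (LinearMap.proj (φ := fun _ => ℂ) i ∘ₗ
      LinearMap.proj (φ := fun _ => Fin r → ℂ) l ∘ₗ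
      LinearMap.snd ℂ (Fin r → d.E) (Fin m → Fin r → ℂ) ∘ₗ
      LinearMap.snd ℂ (signedMatrices r ε) _) z
  · exact Gr.morphismAt_span (f := fun z =>
      ⟨d.deform z, Gr.linearIndependent_of_apply_eq_single (d.p_deform z)⟩)
      fun i => d.morphismAt_deform z i

/-- The chart given by dual frames. -/
noncomputable def chart (P : NCQTilde B m r) (h : Gr.Transverse d.p P.1.2.1) :
    (NCQTilde.str B m r).Chart P (d.ParamSpace m) where
  source := {P | Gr.Transverse d.p P.1.2.1}
  isOpen_source := NCQTilde.isOpen_transverse d.p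
  mem_source := h
  equiv :=
    { toFun := fun P => d.params P.1 P.2
      invFun := fun z => ⟨d.toNCQTilde z, d.transverse_deformSpan z⟩
      left_inv := fun P => Subtype.ext (d.toNCQTilde_params P.1 P.2)
      right_inv := d.params_toNCQTilde }
  isIsomorphism := by
    refine ⟨isMorphism_iff.2 fun P => ?_, isMorphism_iff.2 fun z =>
      .codomain_comap (d.morphismAt_toNCQTilde z)⟩
    have hf : ∀ i, ((NCQTilde.str B m r).restrict {P | Gr.Transverse d.p P.1.2.1}).MorphismAt
        (affine V) (fun P => Gr.frame d.p P.1.1.2.1 i) P := fun i =>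
      (NCQTilde.morphismAt_frame P.2 i).comp (morphismAt_comap _ _ P)
    refine .codomain_prod (.of_injective (Submodule.subtype _) Subtype.val_injective
      (.codomain_pi fun i => .codomain_pi fun j => RegularAt.morphismAt ?_))
      (.codomain_prod (.codomain_pi fun i => (hf i).linear_comp d.projE) (.codomain_pi fun l => ?_))
    · have hE : ∀ i, ((NCQTilde.str B m r).restrict {P | Gr.Transverse d.p P.1.2.1}).MorphismAt
          (affine V) (fun P => (d.projE (Gr.frame d.p P.1.1.2.1 i) : V)) P := fun i =>
        (hf i).linear_comp (d.E.subtype ∘ₗ d.projE)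
      exact ((hf i).regularAt_linear (LinearMap.proj j ∘ₗ d.q)).add
        ((FnStr.const' _ _ _).mul (MorphismAt.bilin B (hE i) (hE j)))
    · exact ((NCQTilde.morphismAt_apply P.1 (Pi.single l 1)).linear_comp d.p).comp
        (morphismAt_comap _ _ P)

theorem finrank_paramSpace (m : ℕ) : Module.finrank ℂ (d.ParamSpace m) =
    Module.finrank ℂ (signedMatrices r ε) + (r * Module.finrank ℂ d.E + m * r) := by
  simp [ParamSpace, Module.finrank_prod, Module.finrank_pi_fintype]

end DualFrames

/-- A basis of the subspace itself serves as the first frame. The coordinates `d.p` map it to the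
standard basis, so the point lies in the domain of the resulting chart. -/
theorem NCQTilde.exists_chart [FiniteDimensional ℂ V] {ε : ℂ} (hB : B.Nondegenerate)
    (hε : ε * ε = 1) (hswap : ∀ x y, B x y = ε * B y x) (P : NCQTilde B m r) :
    ∃ d : DualFrames B ε r, Nonempty ((NCQTilde.str B m r).Chart P (d.ParamSpace m)) := by
  let b := Module.finBasisOfFinrankEq ℂ P.1.2.1.1 P.1.2.1.2
  have hb : LinearIndependent ℂ fun i => (b i : V) :=
    b.linearIndependent.map' P.1.2.1.1.subtype (Submodule.ker_subtype _)
  obtain ⟨d, hd⟩ := DualFrames.exists_of_isotropic hB hε hswap hb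
    fun i j => P.1.2.2 _ (b i).2 _ (b j).2
  have h := (Gr.transverse_span_of_apply_eq_single (p := d.p) (v := ⟨_, hb⟩)
    fun i => by rw [← d.p_u i, hd]).1
  have hU : Stiefel.span V r ⟨_, hb⟩ = P.1.2.1 := by
    refine Subtype.ext ?_
    change Submodule.span ℂ (Set.range (P.1.2.1.1.subtype ∘ b)) = _
    rw [Set.range_comp, Submodule.span_image, b.span_eq, Submodule.map_top,
      Submodule.range_subtype]
  exact ⟨d, ⟨d.chart P (hU ▸ h)⟩⟩

/-! ### The resolution is a variety -/

namespace NCQTilde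

variable [FiniteDimensional ℂ V]

/-- Distinct points are separated by a linear form in the homomorphisms if these differ. Otherwise
they are separated by the failure of a frame vector of the second subspace to lie in the first. -/
theorem isClosed_diagonal :
    IsClosed[((NCQTilde.str B m r).prod (NCQTilde.str B m r)).top]
      (Set.diagonal (NCQTilde B m r)) := by
  refine FnStr.isClosed_diagonal fun P Q hPQ => ?_
  have hfst := morphismAt_fst (NCQTilde.str B m r) (NCQTilde.str B m r) (P, Q)
  have hsnd := morphismAt_snd (NCQTilde.str B m r) (NCQTilde.str B m r) (P, Q)
  by_cases hT : P.1.1.1 = Q.1.1.1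
  · have hU : ¬ Q.1.2.1.1 ≤ P.1.2.1.1 := fun hle => hPQ (NCQTilde.ext hT (Subtype.ext (Subtype.ext
      (Submodule.eq_of_le_of_finrank_eq hle (by rw [P.1.2.1.2, Q.1.2.1.2])).symm)))
    obtain ⟨p, hp⟩ := Gr.exists_transverse P.1.2.1
    obtain ⟨q, hq⟩ := Gr.exists_transverse Q.1.2.1
    have hj : ∃ j, Gr.frame q Q.1.2.1 j ∉ P.1.2.1.1 := by
      by_contra! h
      refine hU (hq.span_frame ▸ Submodule.span_le.2 ?_)
      rintro _ ⟨j, rfl⟩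
      exact h j
    obtain ⟨j, hj⟩ := hj
    -- A vector minus its would-be expansion in the frame of the first subspace: this is zero on the
    -- diagonal wherever `p` is transverse, and nonzero at `(P, Q)` by the choice of `j`.
    let D : NCQTilde B m r × NCQTilde B m r → V := fun z => Gr.frame q z.2.1.2.1 j -
      ∑ i, p (Gr.frame q z.2.1.2.1 j) i • Gr.frame p z.1.1.2.1 i
    have h0 : D (P, Q) ≠ 0 := fun h => hj (by
      rw [sub_eq_zero.1 h]
      exact sum_mem fun i _ => Submodule.smul_mem _ _ (Gr.frame_mem _ _ _))
    have hfq := (NCQTilde.morphismAt_frame hq j).comp hsnd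
    have hD : ((NCQTilde.str B m r).prod (NCQTilde.str B m r)).MorphismAt (affine V) D (P, Q) :=
      hfq.sub (MorphismAt.sum _ fun i _ => MorphismAt.smul
        (hfq.regularAt_linear (LinearMap.proj i ∘ₗ p))
        ((NCQTilde.morphismAt_frame hp i).comp hfst))
    obtain ⟨φ, hφ⟩ := not_forall.1 (mt (Module.forall_dual_apply_eq_zero_iff ℂ _).1 h0)
    refine ⟨fun z => φ (D z), hD.regularAt_linear φ, hφ, ?_⟩
    filter_upwards [hfst.1.eventually (eventually_of_isOpen _ (NCQTilde.isOpen_transverse p) hp)]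
    rintro ⟨R, R'⟩ (hR : Gr.Transverse p R.1.2.1) (rfl : R = R')
    have : D (R, R) = 0 := sub_eq_zero.2 (hR.sum_frame (Gr.frame_mem _ _ _)).symm
    rw [this, map_zero]
  · obtain ⟨φ, hφ⟩ := not_forall.1 (mt (Module.forall_dual_apply_eq_zero_iff ℂ _).1
      (sub_ne_zero.2 hT))
    refine ⟨fun z => φ (z.1.1.1.1 - z.2.1.1.1), ?_, hφ, ?_⟩
    · exact (((morphismAt_hom P).comp hfst).sub ((morphismAt_hom Q).comp hsnd)).regularAt_linear φ
    · refine Filter.Eventually.of_forall ?_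
      rintro ⟨R, R'⟩ (rfl : R = R')
      simp

/-- Pairs of a homomorphism and an isotropic frame whose span contains its image form a subset of a
finite dimensional vector space. Any such subset is Noetherian, and this one maps onto the
resolution. -/
theorem compactSpace : @CompactSpace _ (NCQTilde.str B m r).top := by
  let A : Set (((Fin m → ℂ) →ₗ[ℂ] V) × (Fin r → V)) :=
    {z | LinearIndependent ℂ z.2 ∧ (∀ x ∈ Submodule.span ℂ (Set.range z.2),
      ∀ y ∈ Submodule.span ℂ (Set.range z.2), B x y = 0) ∧
      ∀ x, z.1 x ∈ Submodule.span ℂ (Set.range z.2)}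
  let f : A → NCQTilde B m r := fun z =>
    NCQTilde.mk ⟨Stiefel.span V r ⟨z.1.2, z.2.1⟩, z.2.2.1⟩ z.1.1 z.2.2.2
  refine compactSpace_of_surjective (f := f) (isMorphism_iff.2 fun z => ?_) fun P => ?_
  · have hz := morphismAt_comap (affine (((Fin m → ℂ) →ₗ[ℂ] V) × (Fin r → V))) Subtype.val z
    refine NCQTilde.morphismAt_codomain (fun l => ?_) ?_
    · exact hz.linear_comp (LinearMap.applyₗ (Pi.single l 1) ∘ₗ
        LinearMap.fst ℂ ((Fin m → ℂ) →ₗ[ℂ] V) (Fin r → V))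
    · exact Gr.morphismAt_span (f := fun z : A => ⟨z.1.2, z.2.1⟩) fun i =>
        hz.linear_comp (LinearMap.proj (φ := fun _ => V) i ∘ₗ
          LinearMap.snd ℂ ((Fin m → ℂ) →ₗ[ℂ] V) (Fin r → V))
  · obtain ⟨p, hp⟩ := Gr.exists_transverse P.1.2.1
    refine ⟨⟨(P.1.1.1, Gr.frame p P.1.2.1), Gr.linearIndependent_frame hp, ?_, fun x => ?_⟩,
      NCQTilde.ext rfl (Subtype.ext (Subtype.ext hp.span_frame))⟩
    · simp only [hp.span_frame]
      exact P.1.2.2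
    · simp only [hp.span_frame]
      exact NCQTilde.apply_mem P x

theorem isVariety {ε : ℂ} (hB : B.Nondegenerate) (hε : ε * ε = 1)
    (hswap : ∀ x y, B x y = ε * B y x) : (NCQTilde.str B m r).IsVariety :=
  isVariety_of_charts NCQTilde.compactSpace (fun P => by
    obtain ⟨d, ⟨c⟩⟩ := NCQTilde.exists_chart hB hε hswap P
    exact ⟨_, ⟨c.trans (Module.finBasis ℂ _).equivFun⟩⟩) NCQTilde.isClosed_diagonal

/-- The dimension is pure because `E` has dimension `n - 2 r` in every chart. The zero homomorphism
over any isotropic subspace gives a point. -/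
theorem isSmoothOfDimension {ε : ℂ} (hB : B.Nondegenerate) (hε : ε * ε = 1)
    (hswap : ∀ x y, B x y = ε * B y x) {k : ℕ} (hr : 2 * r + k = Module.finrank ℂ V) :
    (NCQTilde.str B m r).IsSmoothOfDimension
      (Module.finrank ℂ (signedMatrices r ε) + (r * k + m * r)) := by
  refine ⟨?_, fun P => ?_⟩
  · obtain ⟨u, hu, huu⟩ := exists_isotropic_frame hB hε hswap (r := r) (by lia)
    refine ⟨NCQTilde.mk ⟨Stiefel.span V r ⟨u, hu⟩, fun x hx y hy => ?_⟩ 0 fun x => zero_mem _⟩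
    obtain ⟨a, rfl⟩ := (Submodule.mem_span_range_iff_exists_fun ℂ).1 hx
    obtain ⟨b, rfl⟩ := (Submodule.mem_span_range_iff_exists_fun ℂ).1 hy
    simp [huu]
  · obtain ⟨d, ⟨c⟩⟩ := NCQTilde.exists_chart hB hε hswap P
    have hk : Module.finrank ℂ d.E = k := by
      have := d.finrank_E
      lia
    rw [← hk, ← d.finrank_paramSpace]
    exact c.localRing_regular

end NCQTilde

/-- The local trivializations of a tensor product of vector bundles are morphisms. -/
theorem FnStr.morphismAt_trivialization {X : Type*} {S : FnStr X} {E F : X → Type*}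
    [∀ x, AddCommGroup (E x)] [∀ x, Module ℂ (E x)]
    [∀ x, AddCommGroup (F x)] [∀ x, Module ℂ (F x)]
    {TE : FnStr (Σ x, E x)} {TF : FnStr (Σ x, F x)} (e : RegularFrame S E TE)
    (f : RegularFrame S F TF) (z : ↥(e.base ∩ f.base) × (Fin e.rank → Fin f.rank → ℂ)) :
    ((S.restrict (e.base ∩ f.base)).prod (affine (Fin e.rank → Fin f.rank → ℂ))).MorphismAt
      (S.tensorBundle E F TE TF) (fun z => ⟨z.1.1, ∑ a, ∑ b,
        z.2 a b • (e.basis ⟨z.1.1, z.1.2.1⟩ a ⊗ₜ[ℂ] f.basis ⟨z.1.1, z.1.2.2⟩ b)⟩) z :=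
  morphismAt_final (X := Σ x, E x ⊗[ℂ] F x) (ι := RegularFrame S E TE × RegularFrame S F TF)
    (E := fun i => ↥(i.1.base ∩ i.2.base) × (Fin i.1.rank → Fin i.2.rank → ℂ))
    (S := fun i => (S.restrict (i.1.base ∩ i.2.base)).prod
      (affine (Fin i.1.rank → Fin i.2.rank → ℂ)))
    (p := fun i z => ⟨z.1.1, ∑ a, ∑ b,
      z.2 a b • (i.1.basis ⟨z.1.1, z.1.2.1⟩ a ⊗ₜ[ℂ] i.2.basis ⟨z.1.1, z.1.2.2⟩ b)⟩) (e, f) z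

/-! ### The isomorphism with the tensor product -/

/-- The canonical isomorphism `Hom(ℂ ^ m, U) = U ⊗ ℂ ^ m`. -/
noncomputable def homEquivTensor (U : Type*) [AddCommGroup U] [Module ℂ U] (m : ℕ) :
    ((Fin m → ℂ) →ₗ[ℂ] U) ≃ₗ[ℂ] U ⊗[ℂ] (Fin m → ℂ) :=
  ((Pi.basisFun ℂ (Fin m)).constr ℂ).symm ≪≫ₗ (TensorProduct.piScalarRight ℂ ℂ U (Fin m)).symm

theorem homEquivTensor_apply {U : Type*} [AddCommGroup U] [Module ℂ U]
    (T : (Fin m → ℂ) →ₗ[ℂ] U) :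
    homEquivTensor U m T = ∑ l, T (Pi.single l 1) ⊗ₜ[ℂ] Pi.single l 1 := by
  rw [homEquivTensor, LinearEquiv.trans_apply, LinearEquiv.symm_apply_eq, map_sum]
  funext l
  simp [Module.Basis.constr, TensorProduct.piScalarRight_apply, Pi.single_apply]

theorem homEquivTensor_symm_tmul {U : Type*} [AddCommGroup U] [Module ℂ U] (x : U)
    (c : Fin m → ℂ) (l : Fin m) :
    (homEquivTensor U m).symm (x ⊗ₜ c) (Pi.single l 1) = c l • x := by
  simp [homEquivTensor, Module.Basis.constr_apply_fintype, TensorProduct.piScalarRight_apply,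
    Pi.single_apply]

/-- The map `(T, U) ↦ (U, T)`, where `T` is seen as an element of `U ⊗ ℂ ^ m`. -/
noncomputable def tautTensorEquiv (B : LinearMap.BilinForm ℂ V) (m r : ℕ) :
    NCQTilde B m r ≃ TautTensor B r m where
  toFun P := ⟨P.1.2, homEquivTensor P.1.2.1.1 m
    (P.1.1.1.codRestrict P.1.2.1.1 (NCQTilde.apply_mem P))⟩
  invFun z := NCQTilde.mk z.1 (z.1.1.1.subtype ∘ₗ (homEquivTensor z.1.1.1 m).symm z.2)
    fun _ => Subtype.property _
  left_inv P := NCQTilde.ext (by simp [NCQTilde.mk]) rfl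
  right_inv := by
    rintro ⟨U, t⟩
    exact Sigma.ext rfl (heq_of_eq ((homEquivTensor U.1.1 m).apply_symm_apply t))

theorem tautTensorEquiv_eq (U : IsotropicGr B r) (T : (Fin m → ℂ) →ₗ[ℂ] U.1.1)
    (P : NCQTilde B m r) (hU : P.1.2 = U) (hT : P.1.1.1 = U.1.1.subtype ∘ₗ T) :
    tautTensorEquiv B m r P = ⟨U, homEquivTensor U.1.1 m T⟩ := by
  subst hU
  refine Sigma.ext rfl (heq_of_eq (congrArg (homEquivTensor P.1.2.1.1 m) ?_))
  exact LinearMap.ext fun x => Subtype.ext (LinearMap.congr_fun hT x)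

theorem tautTensorEquiv_symm_apply (z : TautTensor B r m) (l : Fin m) :
    ((tautTensorEquiv B m r).symm z).1.1.1 (Pi.single l 1) =
      ((homEquivTensor z.1.1.1 m).symm z.2 (Pi.single l 1) : V) := rfl

/-! ### Regular frames of the tautological and the trivial bundle -/

theorem IsotropicGr.morphismAt_gr (U : IsotropicGr B r) :
    (IsotropicGr.str B r).MorphismAt (Gr.str V r) (fun U => U.1) U :=
  morphismAt_restrict _ U

theorem Taut.morphismAt_coe (z : Σ U : IsotropicGr B r, Taut B r U) :
    (Taut.str B r).MorphismAt (affine V) (fun z => (z.2 : V)) z :=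
  MorphismAt.comp (morphismAt_fst _ _ _) (morphismAt_comap _
    (fun z : Σ U : IsotropicGr B r, Taut B r U => ((z.2 : V), z.1)) z)

theorem Triv.morphismAt_snd (z : Σ U : IsotropicGr B r, Triv B r m U) :
    (Triv.str B r m).MorphismAt (affine (Fin m → ℂ)) (fun z => z.2) z :=
  MorphismAt.comp (g := Prod.fst) (f := fun z : Σ U : IsotropicGr B r, Triv B r m U =>
      ((z.2, z.1) : (Fin m → ℂ) × IsotropicGr B r))
    (morphismAt_fst (affine (Fin m → ℂ)) (IsotropicGr.str B r) _) (morphismAt_comap _ _ z)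

/-- The regular frame of the tautological bundle over the subspaces that are transverse to `p`. -/
noncomputable def tautFrame [FiniteDimensional ℂ V] (B : LinearMap.BilinForm ℂ V)
    (p : V →ₗ[ℂ] (Fin r → ℂ)) :
    RegularFrame (IsotropicGr.str B r) (Taut B r) (Taut.str B r) where
  base := {U | Gr.Transverse p U.1}
  isOpen_base := isOpen_of_eventually _ fun U hU =>
    (morphismAt_comap _ _ U).1.eventually (eventually_of_isOpen _ (Gr.isOpen_transverse p) hU)
  rank := r
  basis U := Gr.Transverse.basis U.2
  regular i := isMorphism_iff.2 fun U => by
    refine .codomain_comap (.prodMk ?_ (morphismAt_comap _ _ U))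
    simp only [Gr.Transverse.coe_basis]
    have hU : ((IsotropicGr.str B r).restrict {U | Gr.Transverse p U.1}).MorphismAt (Gr.str V r)
        (fun U => U.1.1) U := (IsotropicGr.morphismAt_gr U.1).comp (morphismAt_restrict _ U)
    exact MorphismAt.comp (f := fun U : {U : IsotropicGr B r | Gr.Transverse p U.1} => U.1.1)
      (Gr.morphismAt_frame U.2 i) hU

/-- The standard frame of the trivial bundle. -/
noncomputable def trivFrame (B : LinearMap.BilinForm ℂ V) (r m : ℕ) :
    RegularFrame (IsotropicGr.str B r) (Triv B r m) (Triv.str B r m) where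
  base := Set.univ
  isOpen_base := @isOpen_univ _ (IsotropicGr.str B r).top
  rank := m
  basis _ := Pi.basisFun ℂ (Fin m)
  regular _ := isMorphism_iff.2 fun U =>
    .codomain_comap (.prodMk (MorphismAt.const _ _ _) (morphismAt_comap _ _ U))

/-! ### Regularity of the isomorphism in both directions -/

/-- Near each point a single trivialization suffices: the map factors through it, the coefficients
being the coordinates of `p (T e_b)`. -/
theorem isMorphism_tautTensorEquiv [FiniteDimensional ℂ V] :
    (NCQTilde.str B m r).IsMorphism (TautTensor.str B r m) (tautTensorEquiv B m r) := by
  refine isMorphism_iff.2 fun P => ?_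
  obtain ⟨p, hp⟩ := Gr.exists_transverse P.1.2.1
  let O : Set (NCQTilde B m r) := {P | Gr.Transverse p P.1.2.1}
  have hO := NCQTilde.isOpen_transverse (B := B) (m := m) p
  refine MorphismAt.of_restrict (O := O) hO (x := ⟨P, hp⟩) ?_
  let g : O → ↥((tautFrame B p).base ∩ (trivFrame B r m).base) × (Fin r → Fin m → ℂ) :=
    fun Q => (⟨Q.1.1.2, Q.2, trivial⟩, fun a b => p (Q.1.1.1.1 (Pi.single b 1)) a)
  have hg : ((NCQTilde.str B m r).restrict O).MorphismAt
      (((IsotropicGr.str B r).restrict ((tautFrame B p).base ∩ (trivFrame B r m).base)).prod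
        (affine (Fin r → Fin m → ℂ))) g ⟨P, hp⟩ := by
    have h1 : ((NCQTilde.str B m r).restrict O).MorphismAt (IsotropicGr.str B r)
        (fun Q => Q.1.1.2) ⟨P, hp⟩ :=
      MorphismAt.comp (f := fun Q : O => Q.1) (g := fun P : NCQTilde B m r => P.1.2)
        (NCQTilde.morphismAt_isotropicGr P)
        (morphismAt_restrict _ _)
    have h2 : ∀ b, ((NCQTilde.str B m r).restrict O).MorphismAt (affine V)
        (fun Q => Q.1.1.1.1 (Pi.single b 1)) ⟨P, hp⟩ := fun b =>
      MorphismAt.comp (f := fun Q : O => Q.1)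
        (g := fun P : NCQTilde B m r => P.1.1.1 (Pi.single b 1))
        (NCQTilde.morphismAt_apply P (Pi.single b 1))
        (morphismAt_restrict _ _)
    exact .prodMk (.codomain_comap h1) (.codomain_pi fun a => .codomain_pi fun b =>
      (h2 b).linear_comp (LinearMap.proj a ∘ₗ p))
  refine (MorphismAt.comp (f := g) (morphismAt_trivialization (tautFrame B p) (trivFrame B r m)
    (g ⟨P, hp⟩)) hg).congr (Filter.Eventually.of_forall fun Q => Sigma.ext rfl (heq_of_eq ?_))
  change ∑ a : Fin r, ∑ b : Fin m, p (Q.1.1.1.1 (Pi.single b 1)) a •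
    (Gr.Transverse.basis Q.2 a ⊗ₜ[ℂ] Pi.basisFun ℂ (Fin m) b) = homEquivTensor _ m _
  rw [homEquivTensor_apply, Finset.sum_comm]
  refine Finset.sum_congr rfl fun b _ => ?_
  conv_rhs => rw [← (Gr.Transverse.basis Q.2).sum_repr (LinearMap.codRestrict _ _ _ _)]
  rw [TensorProduct.sum_tmul]
  refine Finset.sum_congr rfl fun a _ => ?_
  rw [TensorProduct.smul_tmul', Pi.basisFun_apply]
  -- By construction `p` itself gives the coordinates in the normalized basis.
  rfl

/-- The source has a final structure, so every pair of regular frames `(e_a)`, `(f_b)` has to be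
tested. There `T e_l` is the sum of the `c_ab f_b(l) e_a`, which is regular. -/
theorem isMorphism_tautTensorEquiv_symm :
    (TautTensor.str B r m).IsMorphism (NCQTilde.str B m r) (tautTensorEquiv B m r).symm := by
  refine IsMorphism.of_final ?_
  rintro ⟨F, G⟩
  let S := ((IsotropicGr.str B r).restrict (F.base ∩ G.base)).prod
    (affine (Fin F.rank → Fin G.rank → ℂ))
  change S.IsMorphism _ _
  refine isMorphism_iff.2 fun z => ?_
  have hbase : S.MorphismAt (IsotropicGr.str B r) (fun z => z.1.1) z :=
    MorphismAt.comp (f := fun z : ↥(F.base ∩ G.base) × (Fin F.rank → Fin G.rank → ℂ) => z.1)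
      (morphismAt_restrict _ _) (morphismAt_fst _ _ z)
  have hF : ∀ a, S.MorphismAt (affine V) (fun z => (F.basis ⟨z.1.1, z.1.2.1⟩ a : V)) z := by
    intro a
    have h1 : S.MorphismAt ((IsotropicGr.str B r).restrict F.base)
        (fun z => ⟨z.1.1, z.1.2.1⟩) z := .codomain_comap hbase
    have h2 := (isMorphism_iff.1 (F.regular a) ⟨z.1.1, z.1.2.1⟩).comp h1
    exact MorphismAt.comp (Taut.morphismAt_coe _) h2
  have hG : ∀ b, S.MorphismAt (affine (Fin m → ℂ)) (fun z => G.basis ⟨z.1.1, z.1.2.2⟩ b) z := by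
    intro b
    have h1 : S.MorphismAt ((IsotropicGr.str B r).restrict G.base)
        (fun z => ⟨z.1.1, z.1.2.2⟩) z := .codomain_comap hbase
    have h2 := (isMorphism_iff.1 (G.regular b) ⟨z.1.1, z.1.2.2⟩).comp h1
    exact MorphismAt.comp (Triv.morphismAt_snd _) h2
  have hc : ∀ a b, S.RegularAt (fun z => z.2 a b) z := fun a b =>
    (morphismAt_snd _ _ z).regularAt_linear
      (LinearMap.proj (φ := fun _ => ℂ) b ∘ₗ LinearMap.proj (φ := fun _ => Fin G.rank → ℂ) a)
  refine NCQTilde.morphismAt_codomain (fun l => ?_) ((IsotropicGr.morphismAt_gr _).comp hbase)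
  simp only [tautTensorEquiv_symm_apply, map_sum, map_smul, LinearMap.sum_apply,
    LinearMap.smul_apply, homEquivTensor_symm_tmul, Submodule.coe_sum, Submodule.coe_smul]
  exact MorphismAt.sum _ fun a _ => MorphismAt.sum _ fun b _ => MorphismAt.smul (hc a b)
    (MorphismAt.smul ((hG b).regularAt_linear (LinearMap.proj l)) (hF a))

end NullCone

/-! ### The theorem -/

theorem mainTheorem5 {V : Type*} [AddCommGroup V] [Module ℂ V] [FiniteDimensional ℂ V]
    (B : LinearMap.BilinForm ℂ V) (hB : B.Nondegenerate) (hB' : B.IsSymm ∨ B.IsAlt)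
    (m n r : ℕ) (hn : Module.finrank ℂ V = n) (hr : r = min m (n / 2)) :
    (∃ e : NCQTilde B m r ≃ TautTensor B r m,
      FnStr.IsIsomorphism (NCQTilde.str B m r) (TautTensor.str B r m) e ∧
      (∀ p : NCQTilde B m r, (e p).1 = p.1.2) ∧
      (∀ U : IsotropicGr B r,
        ∃ L : ((Fin m → ℂ) →ₗ[ℂ] Taut B r U) ≃ₗ[ℂ] (Taut B r U ⊗[ℂ] Triv B r m U),
          ∀ (T : (Fin m → ℂ) →ₗ[ℂ] Taut B r U) (p : NCQTilde B m r),
            p.1.2 = U → p.1.1.1 = (Submodule.subtype U.1.1).comp T → e p = ⟨U, L T⟩)) ∧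
    FnStr.IsVariety (NCQTilde.str B m r) ∧
    (B.IsSymm → ∃ d : ℕ, 2 * (d : ℤ) = r * (2 * m + 2 * n - 3 * r - 1) ∧
      FnStr.IsSmoothOfDimension (NCQTilde.str B m r) d) ∧
    (B.IsAlt → ∃ d : ℕ, 2 * (d : ℤ) = r * (2 * m + 2 * n - 3 * r + 1) ∧
      FnStr.IsSmoothOfDimension (NCQTilde.str B m r) d) := by
  subst hn
  have hswap : ∃ ε : ℂ, ε * ε = 1 ∧ ∀ x y, B x y = ε * B y x := by
    rcases hB' with h | h
    · exact ⟨1, one_mul 1, fun x y => by rw [one_mul]; exact h.eq x y⟩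
    · exact ⟨-1, by norm_num, fun x y => by rw [neg_one_mul, h.neg_eq]⟩
  -- Since `r ≤ n / 2`, the number `k = n - 2 r` is a natural number; it is the dimension of `E`.
  obtain ⟨k, hk⟩ : ∃ k, 2 * r + k = Module.finrank ℂ V :=
    ⟨_, Nat.add_sub_cancel' (by lia)⟩
  refine ⟨⟨tautTensorEquiv B m _, ⟨isMorphism_tautTensorEquiv, isMorphism_tautTensorEquiv_symm⟩,
    fun _ => rfl, fun U => ⟨homEquivTensor U.1.1 m, tautTensorEquiv_eq U⟩⟩, ?_, fun h => ?_,
    fun h => ?_⟩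
  · obtain ⟨ε, hε, hswap⟩ := hswap
    exact NCQTilde.isVariety hB hε hswap
  · refine ⟨_, ?_, NCQTilde.isSmoothOfDimension hB (one_mul 1)
      (fun x y => by rw [one_mul]; exact h.eq x y) hk⟩
    have := finrank_signedMatrices_one r
    rw [← hk]
    zify at this
    push_cast
    -- Twice the number of parameters is `r² - r + 2 r (n - 2 r) + 2 m r`. In the alternating case
    -- the first two terms become `r² + r`.
    linear_combination this
  · refine ⟨_, ?_, NCQTilde.isSmoothOfDimension hB (ε := -1) (by norm_num)
      (fun x y => by rw [neg_one_mul, h.neg_eq]) hk⟩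
    have := finrank_signedMatrices_neg_one r
    rw [← hk]
    zify at this
    push_cast
    linear_combination this
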